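/- Let $(S,O)$ be a germ of smooth complex analytic surface, $\mathcal O_{S,O}$ its local algebra, with maximal ideal $\mathcal M$, and $F$ the field of fractions of $\mathcal O_{S,O}$. A \emph{valuation of $F$ dominating $O$} is a map $\nu:F\to\mathbb R\cup\{\infty\}$ such that $\nu(xy)=\nu(x)+\nu(y)$ and $\nu(x+y)\ge\min(\nu(x),\nu(y))$ for all $x,y\in F$, $\nu(0)=\infty$, $\nu(\lambda)=0$ for $\lambda\in\mathbb C^*$, $\nu\ge 0$ on $\mathcal O_{S,O}$ and $\nu>0$ on $\mathcal M$. A \emph{model} of $(S,O)$ is a composition of blow-ups of points $\pi:(\Sigma,E)\to(S,O)$, $E=\pi^{-1}(O)$ (each point blown up lies above $O$, and the first one is $O$). For each point $P$ that has been blown up, let $E_P\subset\Sigma$ denote the strict transform of the exceptional curve created by its blow-up. A point $Q$ of a model is \emph{proximate} to $P$ if it lies on the curve $E_P$ of that model. A point $A\in\Sigma$ above $O$ is a \emph{satellite point} if it lies on two distinct components $E_B$, $E_C$ of $E$; here $B$ and $C$ are named so that $B$ is proximate to $C$, and then $B$ is the \emph{direct predecessor} and $C$ the \emph{indirect predecessor}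 of $A$. The \emph{divisorial valuation} $\nu_A$ is defined by letting $\nu_A(f)$ be the order of vanishing of $f\circ\pi\circ\pi_A$ along $E_A=\pi_A^{-1}(A)$, where $\pi_A:\Sigma_A\to\Sigma$ is the blow-up of $A$. For $(\beta,\gamma)\in\mathbb R_+^2\setminus\{0\}$, the \emph{monomial valuation} $\beta\,\nu_B\oplus\gamma\,\nu_C$ is defined, in local coordinates $(x_B,x_C)$ of $\Sigma$ centred at $A$ such that $E_B=\{x_B=0\}$ and $E_C=\{x_C=0\}$ near $A$, by $$(\beta\,\nu_B\oplus\gamma\,\nu_C)(f)=\min\Bigl\{\beta m+\gamma n \;:\; c_{m,n}\ne 0\Bigr\},\qquad f\circ\pi=\sum_{m,n\ge 0}c_{m,n}\,x_B^{m}x_C^{n},$$ for $f\in\mathcal O_{S,O}$ (with $\min\emptyset=\infty$). Both are extended to $F$ by $f/g\mapsto\nu(f)-\nu(g)$. \textbf{Lemma.} Let $A$ be a satellite point, with direct predecessor $B$ and indirect predecessor $C$. Then $\nu_A$ is a valuation of $F$ dominating $O$, coordinates $(x_B,x_C)$ as above exist at $A$, and, for every choice of such coordinates, $$\nu_A=\nu_B\oplus\nu_C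 ,$$ the monomial valuation with weights $(\beta,\gamma)=(1,1)$. -/

import Mathlib

open scoped Manifold ContDiff Topology ENNReal NNReal
open Filter

noncomputable section

/-! ## Local rings of smooth complex analytic surfaces -/

section LocalRing

variable {M : Type*} [TopologicalSpace M] [ChartedSpace (ℂ × ℂ) M]
variable {N : Type*} [TopologicalSpace N] [ChartedSpace (ℂ × ℂ) N]

/-- The local algebra `𝒪_{M,q}` of germs at `q` of holomorphic functions on the surface `M`. -/
def HolGerm (q : M) : Subring (Germ (𝓝 q) ℂ) where
  carrier := {g | ∃ f : M → ℂ, ContMDiffAt 𝓘(ℂ, ℂ × ℂ) 𝓘(ℂ) ω f q ∧ (f : Germ (𝓝 q) ℂ) = g}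
  mul_mem' := by
    rintro _ _ ⟨f, hf, rfl⟩ ⟨g, hg, rfl⟩
    exact ⟨f * g, hf.mul hg, rfl⟩
  add_mem' := by
    rintro _ _ ⟨f, hf, rfl⟩ ⟨g, hg, rfl⟩
    exact ⟨f + g, hf.add hg, rfl⟩
  zero_mem' := ⟨fun _ => 0, contMDiffAt_const, rfl⟩
  one_mem' := ⟨fun _ => 1, contMDiffAt_const, rfl⟩
  neg_mem' := by
    rintro _ ⟨f, hf, rfl⟩
    exact ⟨-f, hf.neg, rfl⟩

/-- The germ of a constant function. -/
def HolGerm.const (q : M) (r : ℂ) : HolGerm q :=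
  ⟨((fun _ => r : M → ℂ) : Germ (𝓝 q) ℂ), fun _ => r, contMDiffAt_const, rfl⟩

/-- The homomorphism `f ↦ f ∘ φ` from `𝒪_{N,P}` to `𝒪_{M,q}` induced by a map `φ : M → N`
which is holomorphic at `q` and sends `q` to `P`. -/
def HolGerm.pullback (φ : M → N) {q : M} {P : N} (hq : φ q = P)
    (hφ : ContMDiffAt 𝓘(ℂ, ℂ × ℂ) 𝓘(ℂ, ℂ × ℂ) ω φ q) : HolGerm P →+* HolGerm q where
  toFun g := ⟨g.1.compTendsto φ (hq ▸ hφ.continuousAt), by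
    obtain ⟨_, f, hf, rfl⟩ := g
    subst hq
    exact ⟨f ∘ φ, ContMDiffAt.comp q hf hφ, rfl⟩⟩
  map_one' := rfl
  map_zero' := rfl
  map_mul' := by
    rintro ⟨_, f, hf, rfl⟩ ⟨_, g, hg, rfl⟩
    rfl
  map_add' := by
    rintro ⟨_, f, hf, rfl⟩ ⟨_, g, hg, rfl⟩
    rfl

/-- The ideal of `𝒪_{M,q}` of the germs of functions vanishing on the set `E`. -/
def vanishingIdealAt (E : Set M) (q : M) : Ideal (HolGerm q) where
  carrier := {g | ∃ f : M → ℂ, (f : Germ (𝓝 q) ℂ) = g.1 ∧ ∀ᶠ z in 𝓝 q, z ∈ E → f z = 0}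
  zero_mem' := ⟨fun _ => 0, rfl, by simp⟩
  add_mem' := by
    rintro ⟨_, _⟩ ⟨_, _⟩ ⟨f, rfl, hf⟩ ⟨g, rfl, hg⟩
    refine ⟨f + g, rfl, ?_⟩
    filter_upwards [hf, hg] with z h₁ h₂ hz
    simp [h₁ hz, h₂ hz]
  smul_mem' := by
    rintro ⟨_, g, _, rfl⟩ ⟨_, _⟩ ⟨f, rfl, hf⟩
    refine ⟨g * f, rfl, ?_⟩
    filter_upwards [hf] with z h₁ hz
    simp [h₁ hz]

/-- `c` is the family of coefficients of the power series expansion at `q` of the germ `h`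
in the local coordinates `(x, y) = e`: one has `h = ∑ c (m, n) x ^ m y ^ n` near `q`. -/
def IsExpansion (e : OpenPartialHomeomorph M (ℂ × ℂ)) {q : M} (h : HolGerm q)
    (c : ℕ × ℕ → ℂ) : Prop :=
  ∃ f : M → ℂ, (f : Germ (𝓝 q) ℂ) = h.1 ∧
    ∀ᶠ z in 𝓝 q, HasSum (fun m : ℕ × ℕ => c m * (e z).1 ^ m.1 * (e z).2 ^ m.2) (f z)

/-- The minimum of `β m + γ n` over the monomials `x ^ m y ^ n` which occur, with a non-zero
coefficient, in the expansion of the germ `h` in the local coordinates `(x, y) = e`. -/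
def monomialOrder (e : OpenPartialHomeomorph M (ℂ × ℂ)) (β γ : ℝ≥0) {q : M} (h : HolGerm q) :
    ℝ≥0∞ :=
  ⨅ (c : ℕ × ℕ → ℂ) (_ : IsExpansion e h c) (m : ℕ × ℕ) (_ : c m ≠ 0),
    ((β * m.1 + γ * m.2 : ℝ≥0) : ℝ≥0∞)

/-- The field of fractions `F_{M,q}` of `𝒪_{M,q}`. -/
abbrev MerGerm (q : M) : Type _ := FractionRing (HolGerm q)

/-- A valuation of `F_{M,q}` dominating `q`, with values in `ℝ ∪ {∞}`. -/
structure IsDominatingValuation {q : M} (ν : MerGerm q → EReal) : Prop where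
  ne_bot : ∀ x, ν x ≠ ⊥
  map_mul : ∀ x y, ν (x * y) = ν x + ν y
  map_add : ∀ x y, min (ν x) (ν y) ≤ ν (x + y)
  map_zero : ν 0 = ⊤
  map_const : ∀ r : ℂ, r ≠ 0 → ν (algebraMap _ _ (HolGerm.const q r)) = 0
  nonneg : ∀ f : HolGerm q, 0 ≤ ν (algebraMap _ _ f)
  pos : ∀ f : HolGerm q, f.1.value = 0 → 0 < ν (algebraMap _ _ f)

end LocalRing

/-- The extension to the total ring of fractions of a function `v` that turns products into sums,
by `a / b ↦ v a - v b`. -/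
def extendToFractions {R : Type*} [CommRing R] (v : R → ℝ≥0∞) (x : FractionRing R) : EReal :=
  (v (IsLocalization.sec (nonZeroDivisors R) x).1 : EReal) -
    (v (IsLocalization.sec (nonZeroDivisors R) x).2 : EReal)

/-! ## Blow-ups of points -/

/-- The holomorphic map `π : Y → X` between surfaces is the blow-up of the point `p` of `X`: it is
an isomorphism over `X \ {p}`, and in suitable local coordinates `e` centred at `p` it is the
blow-up of the origin of `ℂ²`, that is the gluing of the two maps `(u, v) ↦ (u, u v)` and
`(s, t) ↦ (s t, t)` by `s = 1 / v`, `t = u v`. -/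
structure IsBlowUp {X Y : Type*} [TopologicalSpace X] [ChartedSpace (ℂ × ℂ) X]
    [TopologicalSpace Y] [ChartedSpace (ℂ × ℂ) Y] (π : Y → X) (p : X) : Prop where
  contMDiff : ContMDiff 𝓘(ℂ, ℂ × ℂ) 𝓘(ℂ, ℂ × ℂ) ω π
  iso_away : ∃ s : X → Y, ContMDiffOn 𝓘(ℂ, ℂ × ℂ) 𝓘(ℂ, ℂ × ℂ) ω s {p}ᶜ ∧
    (∀ x, x ≠ p → π (s x) = x) ∧ ∀ y, π y ≠ p → s (π y) = y
  local_form : ∃ e ∈ IsManifold.maximalAtlas 𝓘(ℂ, ℂ × ℂ) ω X,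
    ∃ e₁ ∈ IsManifold.maximalAtlas 𝓘(ℂ, ℂ × ℂ) ω Y,
    ∃ e₂ ∈ IsManifold.maximalAtlas 𝓘(ℂ, ℂ × ℂ) ω Y,
      p ∈ e.source ∧ e p = 0 ∧
      π ⁻¹' e.source = e₁.source ∪ e₂.source ∧
      e₁.target = {w | (w.1, w.1 * w.2) ∈ e.target} ∧
      e₂.target = {w | (w.1 * w.2, w.2) ∈ e.target} ∧
      (∀ y ∈ e₁.source, e (π y) = ((e₁ y).1, (e₁ y).1 * (e₁ y).2)) ∧
      (∀ y ∈ e₂.source, e (π y) = ((e₂ y).1 * (e₂ y).2, (e₂ y).2)) ∧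
      (∀ y ∈ e₁.source, y ∈ e₂.source ↔ (e₁ y).2 ≠ 0) ∧
      (∀ y ∈ e₂.source, y ∈ e₁.source ↔ (e₂ y).1 ≠ 0) ∧
      ∀ y ∈ e₁.source ∩ e₂.source, (e₂ y).1 * (e₁ y).2 = 1

/-- A finite sequence of blow-ups of points
`X length → ⋯ → X 1 → X 0` above the germ of surface `(S, O) = (X 0, p 0)`: the map
`π i : X (i + 1) → X i` is the blow-up of the point `p i`, which lies above `O`.
The points `p i`, for `i < length`, are points infinitely near to `O` (or `O` itself), and every
surface `X i`, for `i ≤ length`, is a model. The data with larger indices are irrelevant. -/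
structure BlowUpSequence (X : ℕ → Type*) [∀ i, TopologicalSpace (X i)]
    [∀ i, ChartedSpace (ℂ × ℂ) (X i)] where
  length : ℕ
  p : ∀ i, X i
  π : ∀ i, X (i + 1) → X i
  /-- The composed map from the `i`-th model to `X 0`. -/
  proj : ∀ i, X i → X 0
  proj_zero : proj 0 = id
  proj_succ : ∀ i, proj (i + 1) = proj i ∘ π i
  isBlowUp : ∀ i < length, IsBlowUp (π i) (p i)
  proj_p : ∀ i < length, proj i (p i) = p 0

namespace BlowUpSequence

variable {X : ℕ → Type*} [∀ i, TopologicalSpace (X i)] [∀ i, ChartedSpace (ℂ × ℂ) (X i)]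
  (T : BlowUpSequence X)

/-- `T.E i m` is the irreducible component of the exceptional divisor of the model `X m` which is
created by the blow-up of `p i`: it is the fibre of `π i` above `p i` if `m = i + 1`, its strict
transform if `m > i + 1`, and it is empty if `m ≤ i`. -/
def E (i : ℕ) : ∀ m, Set (X m)
  | 0 => ∅
  | m + 1 => if m = i then T.π m ⁻¹' {T.p m} else closure (T.π m ⁻¹' (E i m \ {T.p m}))

/-- The point `p i` is proximate to the point `p j`: it lies on the component of the exceptional
divisor which is created by the blow-up of `p j`. -/
def Proximate (i j : ℕ) : Prop := T.p i ∈ T.E j i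

/-- `p a` is a satellite point, with direct predecessor `p b` and indirect predecessor `p c`: it
lies on the two distinct components created by `p b` and `p c`, and `p b` is proximate
to `p c`. -/
structure IsSatellite (a b c : ℕ) : Prop where
  ne : b ≠ c
  proximate_direct : T.Proximate a b
  proximate_indirect : T.Proximate a c
  proximate_predecessors : T.Proximate b c

theorem contMDiff_proj : ∀ m ≤ T.length,
    ContMDiff 𝓘(ℂ, ℂ × ℂ) 𝓘(ℂ, ℂ × ℂ) ω (T.proj m)
  | 0, _ => by rw [T.proj_zero]; exact contMDiff_id
  | m + 1, h => by
    rw [T.proj_succ]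
    exact (contMDiff_proj m (by omega)).comp (T.isBlowUp m h).contMDiff

theorem proj_of_mem_E {a : ℕ} (ha : a < T.length) {q : X (a + 1)} (hq : q ∈ T.E a (a + 1)) :
    T.proj (a + 1) q = T.p 0 := by
  have h : T.π a q = T.p a := by simpa [E] using hq
  rw [T.proj_succ, Function.comp_apply, h, T.proj_p a ha]

/-- The pull-back to the local algebra at a point `q` above `O` of the model `X m`. -/
def pullback {m : ℕ} (hm : m ≤ T.length) {q : X m} (hq : T.proj m q = T.p 0) :
    HolGerm (T.p 0) →+* HolGerm q :=
  HolGerm.pullback (T.proj m) hq (T.contMDiff_proj m hm q)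

/-- The order of vanishing of the pull-back of `f` along the exceptional curve `E_A` created by
the blow-up of `A = p a`: the largest `k` such that, at every point of `E_A`, the pull-back
belongs to the `k`-th power of the ideal of `E_A`. -/
def order {a : ℕ} (ha : a < T.length) (f : HolGerm (T.p 0)) : ℕ∞ :=
  ⨆ (k : ℕ) (_ : ∀ (q : X (a + 1)) (hq : q ∈ T.E a (a + 1)),
    T.pullback ha (T.proj_of_mem_E ha hq) f ∈ vanishingIdealAt (T.E a (a + 1)) q ^ k), (k : ℕ∞)

/-- The divisorial valuation `ν_A` of `F_{S,O}` associated with `A = p a`. -/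
def divisorialValuation {a : ℕ} (ha : a < T.length) : MerGerm (T.p 0) → EReal :=
  extendToFractions fun f => (T.order ha f : ℝ≥0∞)

/-- `e = (x_B, x_C)` is a system of local coordinates centred at the point `A = p a` of the model
`X a`, in which the components `E_B`, `E_C` created by `B = p b` and `C = p c` have the equations
`x_B = 0` and `x_C = 0`. -/
structure IsAdaptedChart (a b c : ℕ) (e : OpenPartialHomeomorph (X a) (ℂ × ℂ)) : Prop where
  mem_atlas : e ∈ IsManifold.maximalAtlas 𝓘(ℂ, ℂ × ℂ) ω (X a)
  mem_source : T.p a ∈ e.source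
  centred : e (T.p a) = 0
  eq_left : ∀ᶠ z in 𝓝 (T.p a), z ∈ T.E b a ↔ (e z).1 = 0
  eq_right : ∀ᶠ z in 𝓝 (T.p a), z ∈ T.E c a ↔ (e z).2 = 0

/-- The monomial valuation `β ν_B ⊕ γ ν_C` of `F_{S,O}`, computed in the local coordinates
`(x_B, x_C) = e` at the point `p a`. -/
def monomialValuation {a : ℕ} (ha : a < T.length) (e : OpenPartialHomeomorph (X a) (ℂ × ℂ))
    (β γ : ℝ≥0) : MerGerm (T.p 0) → EReal :=
  extendToFractions fun f => monomialOrder e β γ (T.pullback ha.le (T.proj_p a ha) f)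

end BlowUpSequence

end

/-!
Write `𝔪` for the maximal ideal of the local algebra at the blown-up point `A = p a`. The value
of each of the two valuations at a germ `f` at `O` is the multiplicity at `A` of the pull-back `g`
of `f`, that is the largest `k` such that `g ∈ 𝔪 ^ k` (`germMult`); this is why they coincide.

* In any coordinates `(x, y)` centred at `A`, Hadamard's lemma shows that `𝔪 = (x, y)`. Hence a germ
  of `𝔪 ^ k` is, modulo `𝔪 ^ (k + 1)`, a homogeneous form of degree `k` in `x` and `y`, and the form
  is detected by the behaviour of the germ on the lines `y = v x`. It follows that `g ∈ 𝔪 ^ k` if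
  and only if `g (t, t v) = O(t ^ k)` for infinitely many `v`
  (`IsCentredChart.mem_maxIdeal_pow_of_ray`), if and only if the expansion of `g` has no monomial of
  degree less than `k` (`IsCentredChart.mem_maxIdeal_pow_iff`). Thus the monomial valuation with
  weights `(1, 1)` is the multiplicity (`IsCentredChart.monomialOrder_one_one`).
* The order of vanishing along `E_A` is the multiplicity as well
  (`IsBlowUp.forall_pullback_mem_iff`): the pull-back of `𝔪` is contained in the ideal of `E_A`, and
  conversely the lines `y = v x` are the images of curves which cross `E_A`.

The multiplicity is a valuation, because the product of two non-zero forms is non-zero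
(`IsCentredChart.mult_mul`). Its composition with the pull-back takes the value `∞` only at `0`,
because the pull-back is injective, by the identity theorem (`IsBlowUp.eventually_eq_zero`).

Adapted coordinates exist because the exceptional divisor has normal crossings at every stage
(`BlowUpSequence.exists_chart_E_inter_E`). In the coordinates where the blow-up is
`(u, v) ↦ (u, u v)`, the strict transform of a smooth curve `f = 0` is `g = 0`, where
`f (u, u v) = u g (u, v)`. When it passes through the origin, `(u, g)` are coordinates there; and
the strict transforms of two transversal curves do not meet over the centre.
-/

noncomputable section

/-! ### Holomorphic functions near the origin of `ℂ²` -/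

/-- Hadamard's lemma: the factor `H` is the sum of the shifted power series of `G`. -/
theorem AnalyticAt.exists_eq_add_apply_self {E F : Type*} [NormedAddCommGroup E] [NormedSpace ℂ E]
    [NormedAddCommGroup F] [NormedSpace ℂ F] [CompleteSpace F] {G : E → F}
    (hG : AnalyticAt ℂ G 0) :
    ∃ H : E → E →L[ℂ] F, AnalyticAt ℂ H 0 ∧ ∀ᶠ w in 𝓝 0, G w = G 0 + H w w := by
  obtain ⟨p, r, hp⟩ := hG
  have hpos : 0 < p.shift.radius := by
    rw [FormalMultilinearSeries.radius_shift]; exact hp.r_pos.trans_le hp.r_le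
  have h1 := p.shift.hasFPowerSeriesOnBall hpos
  refine ⟨p.shift.sum, h1.analyticAt, ?_⟩
  have h2 := (h1.unshift (z := G 0)).mono hp.r_pos
    (by simpa using hp.r_le)
  have hp0 : p.shift.unshift (G 0) = p := by
    funext n
    cases n with
    | zero =>
      ext x
      rw [hp.coeff_zero x]
      simp [FormalMultilinearSeries.unshift]
    | succ n =>
      ext x
      simp [FormalMultilinearSeries.unshift, FormalMultilinearSeries.shift]
  rw [hp0] at h2
  filter_upwards [Metric.eball_mem_nhds (0 : E) hp.r_pos] with w hw
  have := (hp.hasSum hw).unique (h2.hasSum hw)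
  simpa using this

/-- An analytic function of two variables is the sum of an unconditionally convergent double power
series: each homogeneous term of its expansion is expanded by multilinearity. -/
theorem AnalyticAt.exists_expansion {G : ℂ × ℂ → ℂ} (hG : AnalyticAt ℂ G 0) :
    ∃ c : ℕ × ℕ → ℂ, ∀ᶠ w in 𝓝 (0 : ℂ × ℂ),
      HasSum (fun m : ℕ × ℕ => c m * w.1 ^ m.1 * w.2 ^ m.2) (G w) := by
  obtain ⟨p, r, hp⟩ := hG
  let φ : (Σ n : ℕ, Finset (Fin n)) → ℕ × ℕ := fun s => (s.2.card, s.1 - s.2.card)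
  let q : (Σ n : ℕ, Finset (Fin n)) → ℂ := fun s =>
    p s.1 (s.2.piecewise (fun _ => ((1, 0) : ℂ × ℂ)) (fun _ => (0, 1)))
  have hterm : ∀ (w : ℂ × ℂ) (n : ℕ) (s : Finset (Fin n)),
      p n (s.piecewise (fun _ => w.1 • ((1, 0) : ℂ × ℂ)) (fun _ => w.2 • ((0, 1) : ℂ × ℂ)))
        = q ⟨n, s⟩ * w.1 ^ (φ ⟨n, s⟩).1 * w.2 ^ (φ ⟨n, s⟩).2 := by
    intro w n s
    have h1 : (s.piecewise (fun _ => w.1 • ((1, 0) : ℂ × ℂ)) (fun _ => w.2 • ((0, 1) : ℂ × ℂ)))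
        = fun i => (s.piecewise (fun _ => w.1) (fun _ => w.2) i) •
          (s.piecewise (fun _ => ((1, 0) : ℂ × ℂ)) (fun _ => (0, 1)) i) := by
      ext i <;> by_cases hi : i ∈ s <;> simp [hi]
    rw [h1, ContinuousMultilinearMap.map_smul_univ]
    have h2 : ∏ i, s.piecewise (fun _ => w.1) (fun _ => w.2) i
        = w.1 ^ s.card * w.2 ^ (n - s.card) := by
      rw [Finset.prod_piecewise]
      simp [Finset.card_sdiff, Finset.prod_const]
    rw [h2, smul_eq_mul]
    simp only [φ, q]
    ring
  have hsum : ∀ (w : ℂ × ℂ) (n : ℕ), p n (fun _ => w) =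
      ∑ s : Finset (Fin n), q ⟨n, s⟩ * w.1 ^ (φ ⟨n, s⟩).1 * w.2 ^ (φ ⟨n, s⟩).2 := by
    intro w n
    simp_rw [← hterm]
    rw [← ContinuousMultilinearMap.map_add_univ]
    congr 1
    ext i <;> simp
  obtain ⟨ρ, hρ0, hρ⟩ := ENNReal.lt_iff_exists_nnreal_btwn.1 (hp.r_pos.trans_le hp.r_le)
  have hρ0' : 0 < ρ := by simpa using hρ0
  -- the `2 ^ n` terms of degree `n` are each at most `C / 4 ^ n` on the polydisc of radius `ρ / 4`
  have hsummable : ∀ w : ℂ × ℂ, ‖w‖ ≤ ρ / 4 →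
      Summable fun s : (Σ n : ℕ, Finset (Fin n)) => q s * w.1 ^ (φ s).1 * w.2 ^ (φ s).2 := by
    intro w hw
    obtain ⟨C, hC, hbound⟩ := p.norm_mul_pow_le_of_lt_radius hρ
    have hb : ∀ s : (Σ n : ℕ, Finset (Fin n)),
        ‖q s * w.1 ^ (φ s).1 * w.2 ^ (φ s).2‖ ≤ C * (1 / 4) ^ s.1 := by
      rintro ⟨n, s⟩
      rw [← hterm]
      refine (ContinuousMultilinearMap.le_opNorm_mul_pow_of_le (b := ρ / 4) _ ?_).trans ?_
      · refine (pi_norm_le_iff_of_nonneg (by positivity)).2 fun i => ?_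
        have h1 := (norm_fst_le w).trans hw
        have h2 := (norm_snd_le w).trans hw
        by_cases hi : i ∈ s <;> simp [hi, Prod.norm_def, h1, h2]
      · have := hbound n
        calc ‖p n‖ * (ρ / 4 : ℝ) ^ n = (‖p n‖ * ρ ^ n) * (1 / 4) ^ n := by
              rw [div_eq_mul_one_div, mul_pow]; ring
          _ ≤ _ := by gcongr
    refine Summable.of_norm_bounded ?_ hb
    rw [summable_sigma_of_nonneg (fun s => by positivity)]
    refine ⟨fun n => Summable.of_finite, ?_⟩
    have : (fun n : ℕ => ∑' _s : Finset (Fin n), C * (1 / 4 : ℝ) ^ n) =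
        fun n => C * (1 / 2) ^ n := by
      ext n
      rw [tsum_fintype]
      simp only [Finset.sum_const, Finset.card_univ, Fintype.card_finset, Fintype.card_fin,
        nsmul_eq_mul, Nat.cast_pow, Nat.cast_ofNat]
      rw [mul_left_comm, ← mul_pow]; norm_num
    rw [this]
    exact (summable_geometric_of_lt_one (by norm_num) (by norm_num)).mul_left C
  refine ⟨fun m => ∑' s : φ ⁻¹' {m}, q s, ?_⟩
  have hball : ∀ᶠ w in 𝓝 (0 : ℂ × ℂ), ‖w‖ ≤ ρ / 4 := by
    filter_upwards [Metric.closedBall_mem_nhds (0 : ℂ × ℂ) (show (0 : ℝ) < ρ / 4 by positivity)]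
      with w hw
    simpa using hw
  filter_upwards [hball, Metric.eball_mem_nhds (0 : ℂ × ℂ) hp.r_pos] with w hw hwr
  have hs := hsummable w hw
  have h1 : HasSum (fun s : (Σ n : ℕ, Finset (Fin n)) => q s * w.1 ^ (φ s).1 * w.2 ^ (φ s).2)
      (G w) := by
    have h2 := hs.hasSum.sigma (fun n => (hasSum_fintype _))
    have h3 := hp.hasSum hwr
    simp only [zero_add, hsum] at h3
    rw [← h2.unique h3]
    exact hs.hasSum
  have h4 := ((Equiv.sigmaFiberEquiv φ).hasSum_iff.2 h1).sigma
    (g := fun m => (∑' s : φ ⁻¹' {m}, q s) * w.1 ^ m.1 * w.2 ^ m.2) (fun m => by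
      have h5 := (((Equiv.sigmaFiberEquiv φ).summable_iff.2 hs).sigma_factor m).hasSum
      have h6 : (∑' s : φ ⁻¹' {m}, q s) * w.1 ^ m.1 * w.2 ^ m.2 = ∑' s : {s // φ s = m},
          q s * w.1 ^ (φ s).1 * w.2 ^ (φ s).2 := by
        rw [← tsum_mul_right, ← tsum_mul_right]
        exact tsum_congr fun s => by rw [show φ s.1 = m from s.2]
      rw [h6]
      exact h5)
  exact h4

/-- On the line `y = v x`, a double power series without terms of degree less than `k` agrees with
its part of degree `k` up to `O(t ^ (k + 1))`. -/
theorem isBigO_sub_of_hasSum {G : ℂ × ℂ → ℂ} {c : ℕ × ℕ → ℂ}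
    (hc : ∀ᶠ w in 𝓝 (0 : ℂ × ℂ), HasSum (fun m : ℕ × ℕ => c m * w.1 ^ m.1 * w.2 ^ m.2) (G w))
    {k : ℕ} (hk : ∀ m : ℕ × ℕ, m.1 + m.2 < k → c m = 0) (v : ℂ) :
    (fun t : ℂ => G (t, t * v) - t ^ k * ∑ m ∈ Finset.HasAntidiagonal.antidiagonal k, c m * v ^ m.2)
      =O[𝓝 0] fun t => t ^ (k + 1) := by
  have hcont : Tendsto (fun t : ℂ => ((t, t * v) : ℂ × ℂ)) (𝓝 0) (𝓝 0) := by
    have : Continuous (fun t : ℂ => ((t, t * v) : ℂ × ℂ)) := by fun_prop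
    exact this.tendsto' 0 0 (by simp)
  have hev := hcont.eventually hc
  obtain ⟨ε, hε, hball⟩ := Metric.eventually_nhds_iff_ball.1 hev
  let ρ : ℝ := ε / 2
  have hρ : 0 < ρ := by positivity
  have hsum := (hball (ρ : ℂ) (by simp [ρ, abs_of_pos hε]; linarith)).summable.norm
  refine Asymptotics.IsBigO.of_bound
    ((∑' m : ℕ × ℕ, ‖c m * (ρ : ℂ) ^ m.1 * ((ρ : ℂ) * v) ^ m.2‖) / ρ ^ (k + 1)) ?_
  filter_upwards [Metric.ball_mem_nhds (0 : ℂ) hρ] with t ht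
  have htρ : ‖t‖ < ρ := by simpa using ht
  have ht' : t ∈ Metric.ball (0 : ℂ) ε := Metric.ball_subset_ball (by simp [ρ]; linarith) ht
  have h1 := hball t ht'
  have h2 : HasSum (fun m : ℕ × ℕ => if m ∈ Finset.HasAntidiagonal.antidiagonal k then
      c m * t ^ m.1 * (t * v) ^ m.2 else 0)
      (t ^ k * ∑ m ∈ Finset.HasAntidiagonal.antidiagonal k, c m * v ^ m.2) := by
    convert hasSum_sum_of_ne_finset_zero (s := Finset.HasAntidiagonal.antidiagonal k)
      (f := fun m : ℕ × ℕ => if m ∈ Finset.HasAntidiagonal.antidiagonal k then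
        c m * t ^ m.1 * (t * v) ^ m.2 else 0) (fun m hm => if_neg hm) using 1
    swap
    · infer_instance
    rw [Finset.mul_sum]
    refine Finset.sum_congr rfl fun m hm => ?_
    rw [if_pos hm, ← Finset.HasAntidiagonal.mem_antidiagonal.1 hm]
    ring
  have h3 := h1.sub h2
  rw [← h3.tsum_eq]
  have hle : ∀ m : ℕ × ℕ, ‖c m * t ^ m.1 * (t * v) ^ m.2 -
      (if m ∈ Finset.HasAntidiagonal.antidiagonal k then c m * t ^ m.1 * (t * v) ^ m.2 else 0)‖ ≤
      ‖c m * (ρ : ℂ) ^ m.1 * ((ρ : ℂ) * v) ^ m.2‖ / ρ ^ (k + 1) * ‖t‖ ^ (k + 1) := by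
    intro m
    by_cases hm : m.1 + m.2 ≤ k
    · rcases hm.lt_or_eq with hm | hm
      · simp [hk m hm]
      · rw [if_pos (by simpa using hm), sub_self, norm_zero]; positivity
    · rw [if_neg (by simp; omega), sub_zero]
      obtain ⟨d, hd⟩ : ∃ d, m.1 + m.2 = k + 1 + d := ⟨m.1 + m.2 - (k + 1), by omega⟩
      have e1 : ‖c m * t ^ m.1 * (t * v) ^ m.2‖ = ‖c m‖ * ‖v‖ ^ m.2 * ‖t‖ ^ (k + 1) * ‖t‖ ^ d := by
        rw [mul_assoc _ (‖t‖ ^ (k + 1)), ← pow_add, ← hd]; simp; ring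
      have e2 : ‖c m * (ρ : ℂ) ^ m.1 * ((ρ : ℂ) * v) ^ m.2‖ =
          ‖c m‖ * ‖v‖ ^ m.2 * ρ ^ d * ρ ^ (k + 1) := by
        rw [mul_assoc _ (ρ ^ d), ← pow_add, add_comm d, ← hd]; simp [abs_of_pos hρ]; ring
      rw [e1, e2, mul_div_cancel_right₀ _ (by positivity), mul_right_comm]
      gcongr
  have hs' := (hsum.div_const (ρ ^ (k + 1))).mul_right (‖t‖ ^ (k + 1))
  refine (tsum_of_norm_bounded hs'.hasSum hle).trans ?_
  rw [tsum_mul_right, tsum_div_const, norm_pow]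

/-! ### Germs, maximal ideals and multiplicities -/

theorem isBigO_pow_succ_pow (k : ℕ) :
    (fun t : ℂ => t ^ (k + 1)) =O[𝓝 0] fun t => t ^ k := by
  have h : (fun t : ℂ => t) =O[𝓝 0] fun _ => (1 : ℂ) := continuous_id.continuousAt.isBigO_one ℂ
  simpa [pow_succ] using (Asymptotics.isBigO_refl (fun t : ℂ => t ^ k) (𝓝 0)).mul h

theorem eq_zero_of_pow_mul_isBigO {k : ℕ} {a : ℂ}
    (h : (fun t : ℂ => t ^ k * a) =O[𝓝 0] fun t => t ^ (k + 1)) : a = 0 := by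
  obtain ⟨C, hC⟩ := h.bound
  have h1 : ∀ᶠ t : ℂ in 𝓝[≠] 0, ‖a‖ ≤ C * ‖t‖ := by
    filter_upwards [hC.filter_mono nhdsWithin_le_nhds, self_mem_nhdsWithin] with t ht ht0
    have h2 : 0 < ‖t‖ ^ k := by
      have : 0 < ‖t‖ := norm_pos_iff.2 ht0
      positivity
    rw [norm_mul, norm_pow, norm_pow, pow_succ] at ht
    nlinarith
  have h2 : Tendsto (fun t : ℂ => C * ‖t‖) (𝓝[≠] 0) (𝓝 0) := by
    have : Continuous fun t : ℂ => C * ‖t‖ := by fun_prop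
    exact (this.tendsto' 0 0 (by simp)).mono_left nhdsWithin_le_nhds
  exact norm_le_zero_iff.1 (ge_of_tendsto h2 h1)

section Germs

variable {M : Type*} [TopologicalSpace M] [ChartedSpace (ℂ × ℂ) M]

/-- The germ at `q` of a function which is holomorphic at `q`. -/
def HolGerm.mk {q : M} (f : M → ℂ) (hf : ContMDiffAt 𝓘(ℂ, ℂ × ℂ) 𝓘(ℂ) ω f q) : HolGerm q :=
  ⟨(f : Germ (𝓝 q) ℂ), f, hf, rfl⟩

theorem HolGerm.exists_eq_mk {q : M} (g : HolGerm q) : ∃ f hf, g = HolGerm.mk f hf := by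
  obtain ⟨_, f, hf, rfl⟩ := g
  exact ⟨f, hf, rfl⟩

/-- The maximal ideal of the local algebra at `q`: the germs which vanish at `q`. -/
def HolGerm.maxIdeal (q : M) : Ideal (HolGerm q) :=
  RingHom.ker ((Germ.valueRingHom (E := ℂ) (x := q)).comp (HolGerm q).subtype)

theorem HolGerm.mem_maxIdeal {q : M} {g : HolGerm q} : g ∈ HolGerm.maxIdeal q ↔ g.1.value = 0 :=
  Iff.rfl

theorem HolGerm.mk_mem_maxIdeal {q : M} {f : M → ℂ} {hf} :
    (HolGerm.mk f hf : HolGerm q) ∈ HolGerm.maxIdeal q ↔ f q = 0 :=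
  Iff.rfl

theorem HolGerm.sub_const_mem_maxIdeal {q : M} (g : HolGerm q) :
    g - HolGerm.const q g.1.value ∈ HolGerm.maxIdeal q := by
  obtain ⟨f, hf, rfl⟩ := HolGerm.exists_eq_mk g
  exact sub_self (f q)

/-- The order of vanishing along a curve: the ideal of the germs `g` at `q` for which `g (γ t)` is
`O(t ^ k)` when `t` tends to `0`. -/
def HolGerm.orderAlong {q : M} {γ : ℂ → M} (hγ : Tendsto γ (𝓝 0) (𝓝 q)) (k : ℕ) :
    Ideal (HolGerm q) where
  carrier := {g | ∃ f : M → ℂ, (f : Germ (𝓝 q) ℂ) = g.1 ∧ (f ∘ γ) =O[𝓝 0] fun t => t ^ k}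
  zero_mem' := ⟨fun _ => 0, rfl, Asymptotics.isBigO_zero _ _⟩
  add_mem' := by
    rintro ⟨_, _⟩ ⟨_, _⟩ ⟨f, rfl, hf⟩ ⟨g, rfl, hg⟩
    exact ⟨f + g, rfl, hf.add hg⟩
  smul_mem' := by
    rintro ⟨_, g, hg, rfl⟩ ⟨_, _⟩ ⟨f, rfl, hf⟩
    have hb : (g ∘ γ) =O[𝓝 0] fun _ => (1 : ℂ) := (hg.continuousAt.tendsto.comp hγ).isBigO_one ℂ
    exact ⟨g * f, rfl, by simpa using! hb.mul hf⟩

theorem HolGerm.mem_orderAlong {q : M} {γ : ℂ → M} {hγ : Tendsto γ (𝓝 0) (𝓝 q)} {k : ℕ}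
    {f : M → ℂ} {hf} : HolGerm.mk f hf ∈ HolGerm.orderAlong hγ k ↔
      (f ∘ γ) =O[𝓝 0] fun t => t ^ k := by
  refine ⟨?_, fun h => ⟨f, rfl, h⟩⟩
  rintro ⟨f', h, h'⟩
  exact h'.congr' (hγ.eventually (Germ.coe_eq.1 h)) EventuallyEq.rfl

theorem HolGerm.mul_mem_orderAlong {q : M} {γ : ℂ → M} {hγ : Tendsto γ (𝓝 0) (𝓝 q)} {j k : ℕ}
    {g h : HolGerm q} (hg : g ∈ HolGerm.orderAlong hγ j) (hh : h ∈ HolGerm.orderAlong hγ k) :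
    g * h ∈ HolGerm.orderAlong hγ (j + k) := by
  obtain ⟨f, hf, rfl⟩ := HolGerm.exists_eq_mk g
  obtain ⟨f', hf', rfl⟩ := HolGerm.exists_eq_mk h
  rw [mem_orderAlong] at hg hh
  exact ⟨f * f', rfl, by simpa [pow_add] using! hg.mul hh⟩

theorem HolGerm.orderAlong_zero {q : M} {γ : ℂ → M} {hγ : Tendsto γ (𝓝 0) (𝓝 q)}
    (g : HolGerm q) : g ∈ HolGerm.orderAlong hγ 0 := by
  obtain ⟨f, hf, rfl⟩ := HolGerm.exists_eq_mk g
  rw [mem_orderAlong]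
  simpa using (hf.continuousAt.tendsto.comp hγ).isBigO_one ℂ

/-- A germ of the `k`-th power of the maximal ideal vanishes to order `k` on every holomorphic curve
through the point. -/
theorem HolGerm.maxIdeal_pow_le_orderAlong {q : M} {γ : ℂ → M} (hγ : Tendsto γ (𝓝 0) (𝓝 q))
    (h0 : γ 0 = q) (hd : ContMDiffAt 𝓘(ℂ) 𝓘(ℂ, ℂ × ℂ) ω γ 0) (k : ℕ) :
    HolGerm.maxIdeal q ^ k ≤ HolGerm.orderAlong hγ k := by
  induction k with
  | zero => exact fun g _ => orderAlong_zero g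
  | succ k ih =>
    rw [pow_succ, Ideal.mul_le]
    intro g hg h hh
    refine mul_mem_orderAlong (ih hg) ?_
    obtain ⟨f, hf, rfl⟩ := HolGerm.exists_eq_mk h
    rw [mem_orderAlong]
    subst h0
    have h1 : ContMDiffAt 𝓘(ℂ) 𝓘(ℂ) ω (f ∘ γ) 0 := ContMDiffAt.comp 0 hf hd
    have h2 : DifferentiableAt ℂ (f ∘ γ) 0 :=
      (contMDiffAt_iff_contDiffAt.1 h1).differentiableAt (by simp)
    have h3 := h2.isBigO_sub
    simpa [mk_mem_maxIdeal.1 hh] using! h3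

/-- A chart of the surface `M` centred at the point `q`. -/
structure IsCentredChart (e : OpenPartialHomeomorph M (ℂ × ℂ)) (q : M) : Prop where
  mem_atlas : e ∈ IsManifold.maximalAtlas 𝓘(ℂ, ℂ × ℂ) ω M
  mem_source : q ∈ e.source
  centred : e q = 0

namespace IsCentredChart

variable {e : OpenPartialHomeomorph M (ℂ × ℂ)} {q : M}

theorem symm_zero (h : IsCentredChart e q) : e.symm 0 = q := by
  rw [← h.centred, e.left_inv h.mem_source]

theorem zero_mem_target (h : IsCentredChart e q) : (0 : ℂ × ℂ) ∈ e.target := by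
  rw [← h.centred]; exact e.map_source h.mem_source

theorem tendsto (h : IsCentredChart e q) : Tendsto e (𝓝 q) (𝓝 0) := by
  have := (e.continuousAt h.mem_source).tendsto
  rwa [h.centred] at this

theorem tendsto_symm (h : IsCentredChart e q) : Tendsto e.symm (𝓝 0) (𝓝 q) := by
  have := (e.continuousAt_symm h.zero_mem_target).tendsto
  rwa [h.symm_zero] at this

theorem eventually_left_inv (h : IsCentredChart e q) : ∀ᶠ z in 𝓝 q, e.symm (e z) = z :=
  e.eventually_left_inverse h.mem_source

/-- The curve of equation `y = v x` in the chart `e = (x, y)`. -/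
def _root_.chartRay (e : OpenPartialHomeomorph M (ℂ × ℂ)) (v t : ℂ) : M := e.symm (t, t * v)

theorem tendsto_ray (h : IsCentredChart e q) (v : ℂ) : Tendsto (chartRay e v) (𝓝 0) (𝓝 q) := by
  have : Continuous (fun t : ℂ => ((t, t * v) : ℂ × ℂ)) := by fun_prop
  exact h.tendsto_symm.comp (this.tendsto' 0 0 (by simp))

theorem contMDiffAt_ray (h : IsCentredChart e q) (v : ℂ) :
    ContMDiffAt 𝓘(ℂ) 𝓘(ℂ, ℂ × ℂ) ω (chartRay e v) 0 := by
  have h1 := contMDiffAt_symm_of_mem_maximalAtlas h.mem_atlas h.zero_mem_target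
  refine ContMDiffAt.comp (0 : ℂ) (g := e.symm) (f := fun t : ℂ => ((t, t * v) : ℂ × ℂ))
    (by simpa using! h1) ?_
  have : ContDiff ℂ ω (fun t : ℂ => ((t, t * v) : ℂ × ℂ)) := by fun_prop
  exact this.contDiffAt.contMDiffAt

theorem maxIdeal_pow_le_ray (h : IsCentredChart e q) (v : ℂ) (k : ℕ) :
    HolGerm.maxIdeal q ^ k ≤ HolGerm.orderAlong (h.tendsto_ray v) k :=
  HolGerm.maxIdeal_pow_le_orderAlong _ (by simp [chartRay]; exact h.symm_zero)
    (h.contMDiffAt_ray v) k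

theorem analyticAt_comp_symm (h : IsCentredChart e q) {f : M → ℂ}
    (hf : ContMDiffAt 𝓘(ℂ, ℂ × ℂ) 𝓘(ℂ) ω f q) : AnalyticAt ℂ (f ∘ e.symm) 0 := by
  have h1 := contMDiffAt_symm_of_mem_maximalAtlas h.mem_atlas h.zero_mem_target
  have h2 := ContMDiffAt.comp (0 : ℂ × ℂ) (by rwa [h.symm_zero]) h1 (g := f)
  exact (contMDiffAt_iff_contDiffAt.1 h2).analyticAt

theorem contMDiffAt_comp (h : IsCentredChart e q) {G : ℂ × ℂ → ℂ}
    (hG : AnalyticAt ℂ G 0) : ContMDiffAt 𝓘(ℂ, ℂ × ℂ) 𝓘(ℂ) ω (G ∘ e) q := by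
  have h1 := contMDiffAt_of_mem_maximalAtlas h.mem_atlas h.mem_source
  refine ContMDiffAt.comp q ?_ h1
  rw [h.centred]
  exact hG.contDiffAt.contMDiffAt

/-- The first coordinate of a centred chart, as a germ. -/
def fst (h : IsCentredChart e q) : HolGerm q := HolGerm.mk (Prod.fst ∘ e)
  (h.contMDiffAt_comp analyticAt_fst)

/-- The second coordinate of a centred chart, as a germ. -/
def snd (h : IsCentredChart e q) : HolGerm q := HolGerm.mk (Prod.snd ∘ e)
  (h.contMDiffAt_comp analyticAt_snd)

/-- The maximal ideal is generated by the coordinates, by Hadamard's lemma. -/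
theorem maxIdeal_eq_span (h : IsCentredChart e q) :
    HolGerm.maxIdeal q = Ideal.span {h.fst, h.snd} := by
  apply le_antisymm
  · intro g hg
    obtain ⟨f, hf, rfl⟩ := HolGerm.exists_eq_mk g
    obtain ⟨H, hH, hev⟩ := (h.analyticAt_comp_symm hf).exists_eq_add_apply_self
    have a1 : AnalyticAt ℂ (fun w => H w (1, 0)) 0 :=
      ((ContinuousLinearMap.apply ℂ ℂ ((1, 0) : ℂ × ℂ)).analyticAt _).comp hH
    have a2 : AnalyticAt ℂ (fun w => H w (0, 1)) 0 :=
      ((ContinuousLinearMap.apply ℂ ℂ ((0, 1) : ℂ × ℂ)).analyticAt _).comp hH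
    refine Ideal.mem_span_pair.2 ⟨HolGerm.mk _ (h.contMDiffAt_comp a1),
      HolGerm.mk _ (h.contMDiffAt_comp a2), Subtype.ext (Germ.coe_eq.2 ?_)⟩
    filter_upwards [h.tendsto.eventually hev, h.eventually_left_inv] with z hz hz'
    have e1 : (f ∘ e.symm) (e z) = f z := by simp [hz']
    have e2 : (f ∘ e.symm) 0 = 0 := by simpa [h.symm_zero] using! hg
    rw [e1, e2, zero_add] at hz
    have e3 : e z = (e z).1 • ((1, 0) : ℂ × ℂ) + (e z).2 • ((0, 1) : ℂ × ℂ) := by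
      ext <;> simp
    have e4 : H (e z) (e z) = (e z).1 * H (e z) (1, 0) + (e z).2 * H (e z) (0, 1) := by
      conv_lhs => rw [e3]
      rw [map_add, map_smul, map_smul]
      rw [← e3]; rfl
    rw [hz, e4]
    show H (e z) (1, 0) * (e z).1 + H (e z) (0, 1) * (e z).2 = _
    ring
  · rw [Ideal.span_le]
    rintro g (rfl | rfl)
    · show (e q).1 = 0
      rw [h.centred]; rfl
    · show (e q).2 = 0
      rw [h.centred]; rfl

end IsCentredChart

theorem Ideal.span_pair_pow_le {R : Type*} [CommRing R] (x y : R) (k : ℕ) :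
    Ideal.span {x, y} ^ k ≤
      Ideal.span (Set.range fun i : Fin (k + 1) => x ^ (k - i : ℕ) * y ^ (i : ℕ)) := by
  induction k with
  | zero => simp [Ideal.one_eq_top]
  | succ k ih =>
    rw [pow_succ]
    refine (Ideal.mul_mono_left ih).trans ?_
    rw [Ideal.span_mul_span', Ideal.span_le]
    rintro _ ⟨_, ⟨i, rfl⟩, _, (rfl | rfl), rfl⟩
    · refine Ideal.subset_span ⟨i.castSucc, ?_⟩
      have := i.2
      simp only [Fin.val_castSucc]
      rw [show k + 1 - (i : ℕ) = k - i + 1 by omega]; ring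
    · refine Ideal.subset_span ⟨i.succ, ?_⟩
      simp only [Fin.val_succ]
      rw [show k + 1 - ((i : ℕ) + 1) = k - i by omega]; ring

namespace IsCentredChart

variable {e : OpenPartialHomeomorph M (ℂ × ℂ)} {q : M}

/-- A germ of the `k`-th power of the maximal ideal is a form of degree `k` in the coordinates,
modulo the next power. -/
theorem exists_form (h : IsCentredChart e q) {k : ℕ} {g : HolGerm q}
    (hg : g ∈ HolGerm.maxIdeal q ^ k) :
    ∃ a : Fin (k + 1) → ℂ,
      g - ∑ i, HolGerm.const q (a i) * (h.fst ^ (k - i : ℕ) * h.snd ^ (i : ℕ)) ∈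
        HolGerm.maxIdeal q ^ (k + 1) := by
  have h1 := Ideal.span_pair_pow_le h.fst h.snd k (h.maxIdeal_eq_span ▸ hg)
  obtain ⟨c, rfl⟩ := (Ideal.mem_span_range_iff_exists_fun).1 h1
  refine ⟨fun i => (c i).1.value, ?_⟩
  rw [← Finset.sum_sub_distrib]
  refine Ideal.sum_mem _ fun i _ => ?_
  rw [← sub_mul, pow_succ']
  refine Ideal.mul_mem_mul (HolGerm.sub_const_mem_maxIdeal _) ?_
  have hx : h.fst ∈ HolGerm.maxIdeal q := by
    rw [h.maxIdeal_eq_span]; exact Ideal.subset_span (by simp)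
  have hy : h.snd ∈ HolGerm.maxIdeal q := by
    rw [h.maxIdeal_eq_span]; exact Ideal.subset_span (by simp)
  have hi := i.2
  have h2 := Ideal.mul_mem_mul (Ideal.pow_mem_pow hx (k - i)) (Ideal.pow_mem_pow hy i)
  rwa [← pow_add, Nat.sub_add_cancel (by omega)] at h2

/-- The form of degree `k` of a germ of the `k`-th power of the maximal ideal, dehomogenized as a
polynomial `P` in `v`, gives the leading coefficient of the germ on the line `y = v x`. -/
theorem exists_leading (h : IsCentredChart e q) {k : ℕ} {f : M → ℂ} {hf}
    (hg : HolGerm.mk f hf ∈ HolGerm.maxIdeal q ^ k) :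
    ∃ P : Polynomial ℂ, (∀ v, (fun t => f (chartRay e v t) - t ^ k * P.eval v)
        =O[𝓝 0] fun t => t ^ (k + 1)) ∧
      (P = 0 → HolGerm.mk f hf ∈ HolGerm.maxIdeal q ^ (k + 1)) := by
  obtain ⟨a, ha⟩ := h.exists_form hg
  refine ⟨∑ i : Fin (k + 1), Polynomial.monomial (i : ℕ) (a i), fun v => ?_, fun hP => ?_⟩
  · have h1 := h.maxIdeal_pow_le_ray v _ ha
    obtain ⟨F, hF, hO⟩ := h1
    refine hO.congr' ?_ EventuallyEq.rfl
    have h2 : F =ᶠ[𝓝 q] fun z => f z - ∑ i, a i * ((e z).1 ^ (k - i : ℕ) * (e z).2 ^ (i : ℕ)) := by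
      have h4 : (HolGerm.mk f hf - ∑ i, HolGerm.const q (a i) *
          (h.fst ^ (k - i : ℕ) * h.snd ^ (i : ℕ))).1 = Germ.coeRingHom (𝓝 q) (f - ∑ i,
            (fun _ => a i) * ((Prod.fst ∘ e) ^ (k - i : ℕ) * (Prod.snd ∘ e) ^ (i : ℕ))) := by
        rw [map_sub, map_sum, AddSubgroupClass.coe_sub, AddSubmonoidClass.coe_finsetSum]
        rfl
      filter_upwards [Germ.coe_eq.1 (hF.trans h4)] with z hz
      simp [hz, Finset.sum_apply]
    have h3 : ∀ᶠ t : ℂ in 𝓝 0, ((t, t * v) : ℂ × ℂ) ∈ e.target := by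
      have : Continuous (fun t : ℂ => ((t, t * v) : ℂ × ℂ)) := by fun_prop
      exact (this.tendsto' 0 0 (by simp)).eventually
        (e.open_target.mem_nhds h.zero_mem_target)
    filter_upwards [(h.tendsto_ray v).eventually h2, h3] with t ht ht'
    rw [Function.comp_apply, ht]
    simp only [chartRay, e.right_inv ht', Polynomial.eval_finsetSum, Polynomial.eval_monomial,
      Finset.mul_sum]
    congr 1
    refine Finset.sum_congr rfl fun i _ => ?_
    have hi := i.2
    rw [mul_pow]
    have hk : t ^ k = t ^ (k - i : ℕ) * t ^ (i : ℕ) := by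
      rw [← pow_add, Nat.sub_add_cancel (by omega)]
    rw [hk]
    ring
  · have ha0 : ∀ i, a i = 0 := by
      intro i
      have := congr_arg (fun p => p.coeff (i : ℕ)) hP
      simpa [Polynomial.finsetSum_coeff, Polynomial.coeff_monomial, Fin.val_inj] using this
    have hc : HolGerm.const q 0 = 0 := rfl
    simpa [ha0, hc] using ha

/-- A germ which vanishes to order `k` along infinitely many rays belongs to the `k`-th power of the
maximal ideal. -/
theorem mem_maxIdeal_pow_of_ray (h : IsCentredChart e q) {S : Set ℂ} (hS : S.Infinite) {k : ℕ}
    {g : HolGerm q} (hg : ∀ v ∈ S, g ∈ HolGerm.orderAlong (h.tendsto_ray v) k) :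
    g ∈ HolGerm.maxIdeal q ^ k := by
  obtain ⟨f, hf, rfl⟩ := HolGerm.exists_eq_mk g
  simp only [HolGerm.mem_orderAlong] at hg
  induction k with
  | zero => simp [Ideal.one_eq_top]
  | succ k ih =>
    have h1 := ih fun v hv => (hg v hv).trans (isBigO_pow_succ_pow k)
    obtain ⟨P, hP, hP0⟩ := h.exists_leading h1
    refine hP0 (Polynomial.eq_zero_of_infinite_isRoot P (hS.mono fun v hv => ?_))
    refine eq_zero_of_pow_mul_isBigO (k := k) ?_
    simpa using! (hg v hv).sub (hP v)

theorem exists_isExpansion (h : IsCentredChart e q) (g : HolGerm q) :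
    ∃ c, IsExpansion e g c := by
  obtain ⟨f, hf, rfl⟩ := HolGerm.exists_eq_mk g
  obtain ⟨c, hc⟩ := (h.analyticAt_comp_symm hf).exists_expansion
  refine ⟨c, f, rfl, ?_⟩
  filter_upwards [h.tendsto.eventually hc, h.eventually_left_inv] with z hz hz'
  simpa [hz'] using hz

/-- The powers of the maximal ideal are characterized by the vanishing of coefficients, in any
expansion of the germ. -/
theorem mem_maxIdeal_pow_iff (h : IsCentredChart e q) {g : HolGerm q} {c : ℕ × ℕ → ℂ}
    (hc : IsExpansion e g c) (k : ℕ) :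
    g ∈ HolGerm.maxIdeal q ^ k ↔ ∀ m : ℕ × ℕ, m.1 + m.2 < k → c m = 0 := by
  obtain ⟨f', hf', hsum'⟩ := hc
  obtain ⟨f, hf, rfl⟩ := HolGerm.exists_eq_mk g
  have hsum : ∀ᶠ w in 𝓝 (0 : ℂ × ℂ),
      HasSum (fun m : ℕ × ℕ => c m * w.1 ^ m.1 * w.2 ^ m.2) ((f ∘ e.symm) w) := by
    filter_upwards [h.tendsto_symm.eventually hsum',
      h.tendsto_symm.eventually (Germ.coe_eq.1 hf'),
      e.open_target.mem_nhds h.zero_mem_target] with w h1 h2 h3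
    rw [e.right_inv h3, h2] at h1
    exact h1
  constructor
  · intro hg
    induction k with
    | zero => intro m hm; omega
    | succ k ih =>
      have hk := ih (Ideal.pow_le_pow_right k.le_succ hg)
      have h0 : ∀ v, ∑ m ∈ Finset.HasAntidiagonal.antidiagonal k, c m * v ^ m.2 = 0 := by
        intro v
        have h1 := isBigO_sub_of_hasSum hsum hk v
        have h2 := HolGerm.mem_orderAlong.1 (h.maxIdeal_pow_le_ray v _ hg)
        refine eq_zero_of_pow_mul_isBigO (k := k) ?_
        simpa [chartRay] using! h2.sub h1
      have hP : ∑ m ∈ Finset.HasAntidiagonal.antidiagonal k,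
          Polynomial.monomial m.2 (c m) = 0 := by
        refine Polynomial.funext fun v => ?_
        simpa [Polynomial.eval_finsetSum] using h0 v
      intro m hm
      rcases (Nat.lt_succ_iff.1 hm).lt_or_eq with hm | hm
      · exact hk m hm
      · have := congr_arg (fun p => Polynomial.coeff p m.2) hP
        simp only [Polynomial.finsetSum_coeff, Polynomial.coeff_monomial,
          Polynomial.coeff_zero] at this
        rw [Finset.sum_eq_single m] at this
        · simpa using this
        · intro b hb hbm
          rw [if_neg]
          intro hb'
          rw [Finset.HasAntidiagonal.mem_antidiagonal] at hb
          exact hbm (Prod.ext (by omega) hb')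
        · intro hm'
          simp [hm] at hm'
  · intro hk
    refine h.mem_maxIdeal_pow_of_ray Set.infinite_univ fun v _ => ?_
    rw [HolGerm.mem_orderAlong]
    have h1 := (isBigO_sub_of_hasSum hsum hk v).trans (isBigO_pow_succ_pow k)
    have h2 : (fun t : ℂ => t ^ k * ∑ m ∈ Finset.HasAntidiagonal.antidiagonal k, c m * v ^ m.2)
        =O[𝓝 0] fun t => t ^ k := by
      simpa using (Asymptotics.isBigO_refl (fun t : ℂ => t ^ k) (𝓝 0)).mul
        (Asymptotics.isBigO_const_const
          (∑ m ∈ Finset.HasAntidiagonal.antidiagonal k, c m * v ^ m.2) one_ne_zero (𝓝 (0 : ℂ)))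
    simpa [chartRay] using! h1.add h2

end IsCentredChart

/-! ### The multiplicity of a germ -/

theorem ENat.natCast_le_iSup_iff {P : ℕ → Prop} (h0 : P 0) (hP : ∀ j k, j ≤ k → P k → P j) (k : ℕ) :
    (k : ℕ∞) ≤ ⨆ (j : ℕ) (_ : P j), (j : ℕ∞) ↔ P k := by
  refine ⟨fun h => ?_, fun h => le_iSup₂_of_le k h le_rfl⟩
  by_contra hk
  have hk0 : k ≠ 0 := by rintro rfl; exact hk h0
  have h1 : ⨆ (j : ℕ) (_ : P j), (j : ℕ∞) ≤ ((k - 1 : ℕ) : ℕ∞) := by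
    refine iSup₂_le fun j hj => Nat.cast_le.2 ?_
    by_contra hlt
    exact hk (hP k j (by omega) hj)
  have := Nat.cast_le.1 (h.trans h1)
  omega

/-- The multiplicity of a germ at `q`: the largest `k` such that the germ belongs to the `k`-th
power of the maximal ideal. -/
def germMult {q : M} (g : HolGerm q) : ℕ∞ :=
  ⨆ (k : ℕ) (_ : g ∈ HolGerm.maxIdeal q ^ k), (k : ℕ∞)

theorem HolGerm.le_mult_iff {q : M} {g : HolGerm q} {k : ℕ} :
    (k : ℕ∞) ≤ germMult g ↔ g ∈ HolGerm.maxIdeal q ^ k :=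
  ENat.natCast_le_iSup_iff (by simp [Ideal.one_eq_top])
    (fun _ _ h hk => Ideal.pow_le_pow_right h hk) k

theorem HolGerm.min_le_mult_add {q : M} (g h : HolGerm q) :
    min (germMult g) (germMult h) ≤ germMult (g + h) := by
  refine ENat.forall_natCast_le_iff_le.1 fun k hk => ?_
  rw [le_min_iff, le_mult_iff, le_mult_iff] at hk
  exact le_mult_iff.2 (Ideal.add_mem _ hk.1 hk.2)

theorem HolGerm.mult_const {q : M} {r : ℂ} (hr : r ≠ 0) : germMult (HolGerm.const q r) = 0 := by
  by_contra h
  have h1 : ((1 : ℕ) : ℕ∞) ≤ germMult (HolGerm.const q r) := by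
    rw [Nat.cast_one]; exact Order.one_le_iff_pos.2 (pos_iff_ne_zero.2 h)
  rw [le_mult_iff, pow_one] at h1
  exact hr h1

namespace IsCentredChart

variable {e : OpenPartialHomeomorph M (ℂ × ℂ)} {q : M}

/-- With weights `(1, 1)`, the least weight of a monomial of the expansion is the multiplicity. -/
theorem monomialOrder_one_one (h : IsCentredChart e q) (g : HolGerm q) :
    monomialOrder e 1 1 g = (germMult g : ℝ≥0∞) := by
  have hm : ∀ m : ℕ × ℕ, ((1 * m.1 + 1 * m.2 : ℝ≥0) : ℝ≥0∞) = (((m.1 + m.2 : ℕ) : ℕ∞) : ℝ≥0∞) := by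
    intro m; simp
  unfold monomialOrder
  simp only [hm]
  apply le_antisymm
  · obtain ⟨c, hc⟩ := h.exists_isExpansion g
    induction hn : germMult g with
    | top => simp
    | coe n =>
      have h1 : ¬ g ∈ HolGerm.maxIdeal q ^ (n + 1) := by
        rw [← HolGerm.le_mult_iff, hn, Nat.cast_le]; omega
      rw [h.mem_maxIdeal_pow_iff hc] at h1
      push Not at h1
      obtain ⟨m, hm1, hm2⟩ := h1
      refine (iInf₂_le_of_le c hc (iInf₂_le m hm2)).trans ?_
      exact ENat.toENNReal_le.2 (Nat.cast_le.2 (by omega))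
  · refine le_iInf₂ fun c hc => le_iInf₂ fun m hm' => ENat.toENNReal_le.2 ?_
    by_contra hlt
    have h1 : ((m.1 + m.2 + 1 : ℕ) : ℕ∞) ≤ germMult g := by
      rw [Nat.cast_succ]; exact Order.add_one_le_of_lt (not_le.1 hlt)
    rw [HolGerm.le_mult_iff, h.mem_maxIdeal_pow_iff hc] at h1
    exact hm' (h1 m (by omega))

theorem mult_eq_top_iff (h : IsCentredChart e q) {g : HolGerm q} : germMult g = ⊤ ↔ g = 0 := by
  constructor
  · intro hg
    obtain ⟨c, hc⟩ := h.exists_isExpansion g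
    have hc0 : c = 0 := by
      funext m
      refine (h.mem_maxIdeal_pow_iff hc (m.1 + m.2 + 1)).1 ?_ m (by omega)
      rw [← HolGerm.le_mult_iff, hg]; exact le_top
    obtain ⟨f, hf, hsum⟩ := hc
    refine Subtype.ext (hf.symm.trans (Germ.coe_eq.2 ?_))
    filter_upwards [hsum] with z hz
    simp only [hc0, Pi.zero_apply, zero_mul] at hz
    exact hz.unique hasSum_zero
  · rintro rfl
    refine ENat.eq_top_iff_forall_ge.2 fun k => ?_
    exact HolGerm.le_mult_iff.2 (zero_mem _)

/-- The leading form of a product is the product of the leading forms. -/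
theorem mult_mul (h : IsCentredChart e q) (g g' : HolGerm q) :
    germMult (g * g') = germMult g + germMult g' := by
  by_cases hg : g = 0
  · rw [hg, zero_mul, h.mult_eq_top_iff.2 rfl, top_add]
  by_cases hg' : g' = 0
  · rw [hg', mul_zero, h.mult_eq_top_iff.2 rfl, add_top]
  obtain ⟨k, hk⟩ := ENat.ne_top_iff_exists.1 (mt h.mult_eq_top_iff.1 hg)
  obtain ⟨l, hl⟩ := ENat.ne_top_iff_exists.1 (mt h.mult_eq_top_iff.1 hg')
  have hk1 := HolGerm.le_mult_iff.1 hk.le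
  have hl1 := HolGerm.le_mult_iff.1 hl.le
  have hk2 : ¬ g ∈ HolGerm.maxIdeal q ^ (k + 1) := by
    rw [← HolGerm.le_mult_iff, ← hk, Nat.cast_le]; omega
  have hl2 : ¬ g' ∈ HolGerm.maxIdeal q ^ (l + 1) := by
    rw [← HolGerm.le_mult_iff, ← hl, Nat.cast_le]; omega
  have hkl : g * g' ∈ HolGerm.maxIdeal q ^ (k + l) := by
    rw [pow_add]; exact Ideal.mul_mem_mul hk1 hl1
  rw [← hk, ← hl, ← Nat.cast_add]
  refine le_antisymm ?_ (HolGerm.le_mult_iff.2 hkl)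
  by_contra hlt
  have h1 : ((k + l + 1 : ℕ) : ℕ∞) ≤ germMult (g * g') := by
    rw [Nat.cast_succ]; exact Order.add_one_le_of_lt (not_le.1 hlt)
  rw [HolGerm.le_mult_iff] at h1
  obtain ⟨f, hf, rfl⟩ := HolGerm.exists_eq_mk g
  obtain ⟨f', hf', rfl⟩ := HolGerm.exists_eq_mk g'
  obtain ⟨P, hP, hP0⟩ := h.exists_leading hk1
  obtain ⟨Q, hQ, hQ0⟩ := h.exists_leading hl1
  have hPQ : P * Q = 0 := by
    refine Polynomial.funext fun v => ?_
    rw [Polynomial.eval_zero]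
    refine eq_zero_of_pow_mul_isBigO (k := k + l) ?_
    have h2 := (HolGerm.mem_orderAlong (f := f * f') (hf := hf.mul hf')).1
      (h.maxIdeal_pow_le_ray v _ h1)
    have h3 : (fun t => f (chartRay e v t)) =O[𝓝 0] fun t => t ^ k :=
      HolGerm.mem_orderAlong.1 (h.maxIdeal_pow_le_ray v _ hk1)
    have h4 := h3.mul (hQ v)
    have h5 : (fun t : ℂ => t ^ l * Q.eval v) =O[𝓝 0] fun t => t ^ l := by
      simpa using (Asymptotics.isBigO_refl (fun t : ℂ => t ^ l) (𝓝 0)).mul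
        (Asymptotics.isBigO_const_const (Q.eval v) one_ne_zero (𝓝 (0 : ℂ)))
    have h6 := (hP v).mul h5
    have h7 : (fun t : ℂ => t ^ k * t ^ (l + 1)) = fun t => t ^ (k + l + 1) := by
      funext t; ring
    have h8 : (fun t : ℂ => t ^ (k + 1) * t ^ l) = fun t => t ^ (k + l + 1) := by
      funext t; ring
    rw [h7] at h4
    rw [h8] at h6
    refine ((h2.sub h4).sub h6).congr_left fun t => ?_
    simp only [Function.comp_apply, Pi.mul_apply, Polynomial.eval_mul]
    ring
  rcases mul_eq_zero.1 hPQ with hz | hz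
  · exact hk2 (hP0 hz)
  · exact hl2 (hQ0 hz)

end IsCentredChart

end Germs

/-! ### Construction of charts -/

section Charts

variable {M : Type*} [TopologicalSpace M] [ChartedSpace (ℂ × ℂ) M]

/-- Composing a chart with a local biholomorphism of `ℂ²` gives a chart: this is the inverse
function theorem. -/
theorem exists_centredChart_of_comp [IsManifold 𝓘(ℂ, ℂ × ℂ) ω M]
    {e : OpenPartialHomeomorph M (ℂ × ℂ)} {q : M}
    (he : e ∈ IsManifold.maximalAtlas 𝓘(ℂ, ℂ × ℂ) ω M) (hq : q ∈ e.source)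
    {Φ : ℂ × ℂ → ℂ × ℂ} {L : (ℂ × ℂ) ≃L[ℂ] (ℂ × ℂ)} (hΦ : ContDiffAt ℂ ω Φ (e q))
    (hL : HasFDerivAt Φ (L : (ℂ × ℂ) →L[ℂ] (ℂ × ℂ)) (e q)) (h0 : Φ (e q) = 0) :
    ∃ e', IsCentredChart e' q ∧ ∀ᶠ z in 𝓝 q, e' z = Φ (e z) := by
  let Ψ₀ := hΦ.toOpenPartialHomeomorph Φ hL (by simp)
  have hmem : e q ∈ Ψ₀.source := hΦ.mem_toOpenPartialHomeomorph_source hL (by simp)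
  -- the inverse function theorem gives a homeomorphism, restricted here to where it is
  -- biholomorphic
  let Ψ := Ψ₀.restrContDiff ℂ ω (by simp)
  have hs : ContDiffAt ℂ ω Ψ₀.symm (Ψ₀ (e q)) := by
    refine Ψ₀.contDiffAt_symm (f₀' := L) (Ψ₀.map_source hmem) ?_ ?_
    · rw [Ψ₀.left_inv hmem]; exact hL
    · rw [Ψ₀.left_inv hmem]; exact hΦ
  have hmem' : e q ∈ Ψ.source := ⟨hmem, hΦ, hs⟩
  have h1 : ContMDiffOn 𝓘(ℂ, ℂ × ℂ) 𝓘(ℂ, ℂ × ℂ) ω Ψ Ψ.source :=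
    (Ψ₀.contDiffOn_restrContDiff_source ℂ (by simp)).contMDiffOn
  have h2 : ContMDiffOn 𝓘(ℂ, ℂ × ℂ) 𝓘(ℂ, ℂ × ℂ) ω Ψ.symm Ψ.target :=
    (Ψ₀.contDiffOn_restrContDiff_target ℂ (by simp)).contMDiffOn
  have hq' : q ∈ (e.trans Ψ).source := by simp [hq, hmem']
  refine ⟨e.trans Ψ, ⟨OpenPartialHomeomorph.mem_maximalAtlas_of_contMDiffOn _ ?_ ?_, hq', ?_⟩, ?_⟩
  · rw [OpenPartialHomeomorph.coe_trans, OpenPartialHomeomorph.trans_source]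
    exact h1.comp ((contMDiffOn_of_mem_maximalAtlas he).mono (by simp)) (fun z hz => hz.2)
  · rw [OpenPartialHomeomorph.coe_trans_symm, OpenPartialHomeomorph.trans_target]
    exact (contMDiffOn_symm_of_mem_maximalAtlas he).comp (h2.mono (by simp)) (fun z hz => hz.2)
  · exact h0
  · exact Eventually.of_forall fun z => rfl

theorem exists_isCentredChart [IsManifold 𝓘(ℂ, ℂ × ℂ) ω M] (q : M) : ∃ e, IsCentredChart e q := by
  obtain ⟨e, he, -⟩ := exists_centredChart_of_comp
    (IsManifold.chart_mem_maximalAtlas (I := 𝓘(ℂ, ℂ × ℂ)) (n := ω) q)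
    (mem_chart_source (ℂ × ℂ) q) (Φ := fun w => w - chartAt (ℂ × ℂ) q q)
    (L := ContinuousLinearEquiv.refl ℂ (ℂ × ℂ)) (by fun_prop)
    ((hasFDerivAt_id _).sub_const _) (sub_self _)
  exact ⟨e, he⟩

theorem IsCentredChart.exists_swap [IsManifold 𝓘(ℂ, ℂ × ℂ) ω M]
    {e : OpenPartialHomeomorph M (ℂ × ℂ)} {q : M}
    (h : IsCentredChart e q) : ∃ e', IsCentredChart e' q ∧ ∀ᶠ z in 𝓝 q, e' z = (e z).swap := by
  refine exists_centredChart_of_comp h.mem_atlas h.mem_source (Φ := Prod.swap)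
    (L := ContinuousLinearEquiv.prodComm ℂ ℂ ℂ) ?_ ?_ (by simp [h.centred])
  · exact (contDiff_snd.prodMk contDiff_fst).contDiffAt
  · exact (ContinuousLinearEquiv.prodComm ℂ ℂ ℂ).hasFDerivAt

/-- The derivative of a change of centred charts is invertible. -/
theorem IsCentredChart.exists_hasFDerivAt {e e' : OpenPartialHomeomorph M (ℂ × ℂ)} {q : M}
    (h : IsCentredChart e q) (h' : IsCentredChart e' q) :
    ∃ L : (ℂ × ℂ) ≃L[ℂ] (ℂ × ℂ),
      HasFDerivAt (e' ∘ e.symm) (L : (ℂ × ℂ) →L[ℂ] (ℂ × ℂ)) 0 := by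
  have key : ∀ {e e' : OpenPartialHomeomorph M (ℂ × ℂ)}, IsCentredChart e q →
      IsCentredChart e' q → DifferentiableAt ℂ (e' ∘ e.symm) 0 := by
    intro e e' h h'
    have h1 := contMDiffAt_symm_of_mem_maximalAtlas h.mem_atlas h.zero_mem_target
    have h2 := contMDiffAt_of_mem_maximalAtlas h'.mem_atlas h'.mem_source
    have h3 := ContMDiffAt.comp (0 : ℂ × ℂ) (by rwa [h.symm_zero]) h1 (g := e')
    exact (contMDiffAt_iff_contDiffAt.1 h3).differentiableAt (by simp)
  have key2 : ∀ {e e' : OpenPartialHomeomorph M (ℂ × ℂ)}, IsCentredChart e q →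
      IsCentredChart e' q → (fderiv ℂ (e ∘ e'.symm) 0).comp (fderiv ℂ (e' ∘ e.symm) 0) =
        ContinuousLinearMap.id ℂ (ℂ × ℂ) := by
    intro e e' h h'
    have h0 : (e' ∘ e.symm) 0 = 0 := by simp [h.symm_zero, h'.centred]
    have h1 := (key h h').hasFDerivAt
    have h2 : HasFDerivAt (e ∘ e'.symm) (fderiv ℂ (e ∘ e'.symm) 0) ((e' ∘ e.symm) 0) := by
      rw [h0]; exact (key h' h).hasFDerivAt
    refine (h2.comp 0 h1).unique ((hasFDerivAt_id (0 : ℂ × ℂ)).congr_of_eventuallyEq ?_)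
    filter_upwards [h.tendsto_symm.eventually h'.eventually_left_inv,
      e.open_target.mem_nhds h.zero_mem_target] with w h3 h4
    simp [h3, e.right_inv h4]
  refine ⟨ContinuousLinearEquiv.equivOfInverse (fderiv ℂ (e' ∘ e.symm) 0)
    (fderiv ℂ (e ∘ e'.symm) 0) (fun w => ?_) (fun w => ?_), ?_⟩
  · exact congr_arg (fun L => L w) (key2 h h')
  · exact congr_arg (fun L => L w) (key2 h' h)
  · exact (key h h').hasFDerivAt

end Charts

/-! ### The blow-up of a point -/

namespace IsBlowUp

variable {X Y : Type*} [TopologicalSpace X] [ChartedSpace (ℂ × ℂ) X]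
  [TopologicalSpace Y] [ChartedSpace (ℂ × ℂ) Y] {π : Y → X} {p : X}

theorem tendsto (h : IsBlowUp π p) {q : Y} (hq : π q = p) : Tendsto π (𝓝 q) (𝓝 p) := by
  have := h.contMDiff.continuous.tendsto q
  rwa [hq] at this

/-- Near a point of the exceptional curve, the blow-up is `(u, v) ↦ (u, u v)` in suitable centred
charts. -/
theorem exists_charts [IsManifold 𝓘(ℂ, ℂ × ℂ) ω X] [IsManifold 𝓘(ℂ, ℂ × ℂ) ω Y]
    (h : IsBlowUp π p) {q : Y} (hq : π q = p) :
    ∃ (e : OpenPartialHomeomorph X (ℂ × ℂ)) (ψ : OpenPartialHomeomorph Y (ℂ × ℂ)),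
      IsCentredChart e p ∧ IsCentredChart ψ q ∧
        ∀ᶠ y in 𝓝 q, e (π y) = ((ψ y).1, (ψ y).1 * (ψ y).2) := by
  obtain ⟨e, he, e₁, he₁, e₂, he₂, hp, hp0, hsrc, -, -, h₁, h₂, -⟩ := h.local_form
  have hcont := h.tendsto hq
  have hq' : q ∈ e₁.source ∪ e₂.source := by
    rw [← hsrc, Set.mem_preimage, hq]; exact hp
  rcases hq' with hq' | hq'
  -- in the chart `(u, v)`, centre at `q = (0, v₀)` and use the coordinates `(x, y - v₀ x)` of `X`
  · have hu : (e₁ q).1 = 0 := by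
      have := h₁ q hq'
      rw [hq, hp0] at this
      exact (congr_arg Prod.fst this).symm
    set v := (e₁ q).2
    obtain ⟨ψ, hψ, hψe⟩ := exists_centredChart_of_comp he₁ hq' (Φ := fun w => w - (0, v))
      (L := ContinuousLinearEquiv.refl ℂ (ℂ × ℂ)) (by fun_prop) ((hasFDerivAt_id _).sub_const _)
      (by ext <;> simp [hu, v])
    let L : (ℂ × ℂ) ≃L[ℂ] (ℂ × ℂ) := ContinuousLinearEquiv.equivOfInverse
      ((ContinuousLinearMap.fst ℂ ℂ ℂ).prod
        (ContinuousLinearMap.snd ℂ ℂ ℂ - v • ContinuousLinearMap.fst ℂ ℂ ℂ))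
      ((ContinuousLinearMap.fst ℂ ℂ ℂ).prod
        (ContinuousLinearMap.snd ℂ ℂ ℂ + v • ContinuousLinearMap.fst ℂ ℂ ℂ))
      (fun w => by ext <;> simp) (fun w => by ext <;> simp)
    obtain ⟨e', he', hee'⟩ := exists_centredChart_of_comp he hp (Φ := L) (L := L)
      L.contDiff.contDiffAt L.hasFDerivAt (by simp [hp0])
    refine ⟨e', ψ, he', hψ, ?_⟩
    filter_upwards [hψe, hcont.eventually hee', e₁.open_source.mem_nhds hq'] with y h3 h4 h5
    rw [h4, h3, h₁ y h5]
    ext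
    · simp [L]
    · simp [L]; ring
  -- in the chart `(s, t)`, the roles of the two coordinates are exchanged
  · have hu : (e₂ q).2 = 0 := by
      have := h₂ q hq'
      rw [hq, hp0] at this
      exact (congr_arg Prod.snd this).symm
    set v := (e₂ q).1
    let S : (ℂ × ℂ) ≃L[ℂ] (ℂ × ℂ) := ContinuousLinearEquiv.prodComm ℂ ℂ ℂ
    obtain ⟨ψ, hψ, hψe⟩ := exists_centredChart_of_comp he₂ hq' (Φ := fun w => S w - (0, v))
      (L := S) (by fun_prop) (S.hasFDerivAt.sub_const _) (by ext <;> simp [hu, v, S])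
    let L : (ℂ × ℂ) ≃L[ℂ] (ℂ × ℂ) := ContinuousLinearEquiv.equivOfInverse
      ((ContinuousLinearMap.snd ℂ ℂ ℂ).prod
        (ContinuousLinearMap.fst ℂ ℂ ℂ - v • ContinuousLinearMap.snd ℂ ℂ ℂ))
      ((ContinuousLinearMap.snd ℂ ℂ ℂ + v • ContinuousLinearMap.fst ℂ ℂ ℂ).prod
        (ContinuousLinearMap.fst ℂ ℂ ℂ))
      (fun w => by ext <;> simp) (fun w => by ext <;> simp)
    obtain ⟨e', he', hee'⟩ := exists_centredChart_of_comp he hp (Φ := L) (L := L)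
      L.contDiff.contDiffAt L.hasFDerivAt (by simp [hp0])
    refine ⟨e', ψ, he', hψ, ?_⟩
    filter_upwards [hψe, hcont.eventually hee', e₂.open_source.mem_nhds hq'] with y h3 h4 h5
    rw [h4, h3, h₂ y h5]
    ext
    · simp [L, S]
    · simp [L, S]; ring

theorem eventually_mem_fibre_iff (h : IsBlowUp π p) {q : Y} (hq : π q = p)
    {e : OpenPartialHomeomorph X (ℂ × ℂ)} {ψ : OpenPartialHomeomorph Y (ℂ × ℂ)}
    (he : IsCentredChart e p)
    (hev : ∀ᶠ y in 𝓝 q, e (π y) = ((ψ y).1, (ψ y).1 * (ψ y).2)) :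
    ∀ᶠ y in 𝓝 q, π y = p ↔ (ψ y).1 = 0 := by
  have hcont := h.tendsto hq
  filter_upwards [hev, hcont.eventually (e.open_source.mem_nhds he.mem_source)] with y h1 h2
  constructor
  · intro hy
    rw [hy, he.centred] at h1
    exact (congr_arg Prod.fst h1).symm
  · intro hy
    refine e.injOn h2 he.mem_source ?_
    rw [h1, he.centred, hy, zero_mul]; rfl

theorem _root_.IsCentredChart.frequently_fst_ne {ψ : OpenPartialHomeomorph Y (ℂ × ℂ)} {q : Y}
    (hψ : IsCentredChart ψ q) : ∃ᶠ y in 𝓝 q, (ψ y).1 ≠ 0 := by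
  intro hev
  have h1 : Tendsto (fun t : ℂ => ((t, 0) : ℂ × ℂ)) (𝓝[≠] 0) (𝓝 0) := by
    have : Continuous (fun t : ℂ => ((t, 0) : ℂ × ℂ)) := by fun_prop
    exact (this.tendsto' 0 0 rfl).mono_left nhdsWithin_le_nhds
  have h2 := (hψ.tendsto_symm.comp h1).eventually hev
  have h3 := h1.eventually (ψ.open_target.mem_nhds hψ.zero_mem_target)
  obtain ⟨t, ht2, ht3, ht⟩ := (h2.and (h3.and self_mem_nhdsWithin)).exists
  simp only [Function.comp_apply, not_not] at ht2
  rw [ψ.right_inv ht3] at ht2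
  exact ht ht2

/-- The complement of the exceptional curve is dense. -/
theorem frequently_ne [IsManifold 𝓘(ℂ, ℂ × ℂ) ω X] [IsManifold 𝓘(ℂ, ℂ × ℂ) ω Y]
    (h : IsBlowUp π p) (y : Y) : ∃ᶠ y' in 𝓝 y, π y' ≠ p := by
  by_cases hy : π y = p
  · obtain ⟨e, ψ, he, hψ, hev⟩ := h.exists_charts hy
    have h1 := h.eventually_mem_fibre_iff hy he hev
    exact (hψ.frequently_fst_ne.and_eventually h1).mono fun y' hy' => (mt hy'.2.1) hy'.1
  · intro hev
    exact hev.self_of_nhds hy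

/-- A holomorphic function vanishes if its pull-back by a blow-up does. -/
theorem eventually_eq_zero [T1Space X] [IsManifold 𝓘(ℂ, ℂ × ℂ) ω X] [IsManifold 𝓘(ℂ, ℂ × ℂ) ω Y]
    (h : IsBlowUp π p) {y : Y} {F : X → ℂ}
    (hF : ContMDiffAt 𝓘(ℂ, ℂ × ℂ) 𝓘(ℂ) ω F (π y)) (hz : ∀ᶠ z in 𝓝 y, F (π z) = 0) :
    ∀ᶠ x in 𝓝 (π y), F x = 0 := by
  obtain ⟨e, he⟩ := exists_isCentredChart (π y)
  have hG := (he.analyticAt_comp_symm hF).eventually_analyticAt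
  obtain ⟨r, hr, hball⟩ := Metric.eventually_nhds_iff_ball.1
    (hG.and (e.open_target.mem_nhds he.zero_mem_target))
  have hcont := h.contMDiff.continuous
  have hU : ∀ᶠ x in 𝓝 (π y), x ∈ e.source ∧ e x ∈ Metric.ball (0 : ℂ × ℂ) r :=
    Eventually.and (e.open_source.mem_nhds he.mem_source)
      (he.tendsto.eventually (Metric.ball_mem_nhds 0 hr))
  obtain ⟨s, hs, hs1, hs2⟩ := h.iso_away
  obtain ⟨y', hy'p, hy'z, hy's, hy'b⟩ := ((h.frequently_ne y).and_eventually
    (hz.eventually_nhds.and (hcont.continuousAt.eventually hU))).exists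
  -- away from `p`, the section `s` carries the vanishing of the pull-back to that of `F`
  have h1 : ∀ᶠ x in 𝓝 (π y'), F x = 0 := by
    have hopen : ({p}ᶜ : Set X) ∈ 𝓝 (π y') := isOpen_compl_singleton.mem_nhds hy'p
    have hsc : Tendsto s (𝓝 (π y')) (𝓝 y') := by
      have := ((hs.continuousOn.continuousAt hopen)).tendsto
      rwa [hs2 y' hy'p] at this
    filter_upwards [hsc.eventually hy'z, hopen] with x h2 h3
    rwa [hs1 x h3] at h2
  have h2 : (F ∘ e.symm) =ᶠ[𝓝 (e (π y'))] 0 := by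
    have h3 := (e.continuousAt_symm (e.map_source hy's)).tendsto
    rw [e.left_inv hy's] at h3
    exact h3.eventually h1
  have h3 := AnalyticOnNhd.eqOn_zero_of_preconnected_of_eventuallyEq_zero
    (fun w hw => (hball w hw).1) (convex_ball (0 : ℂ × ℂ) r).isPreconnected hy'b h2
  filter_upwards [hU] with x hx
  have := h3 hx.2
  simpa [e.left_inv hx.1] using this

/-- The multiplicity of a germ at the centre of a blow-up is the order of vanishing of its pull-back
along the exceptional curve. -/
theorem forall_pullback_mem_iff (h : IsBlowUp π p) (g : HolGerm p) (k : ℕ) :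
    (∀ (q : Y) (hq : π q = p), HolGerm.pullback π hq (h.contMDiff q) g ∈
      vanishingIdealAt (π ⁻¹' {p}) q ^ k) ↔ g ∈ HolGerm.maxIdeal p ^ k := by
  constructor
  · intro hg
    obtain ⟨e, he, e₁, he₁, e₂, he₂, hp, hp0, hsrc, ht₁, -, h₁, -, -⟩ := h.local_form
    have hec : IsCentredChart e p := ⟨he, hp, hp0⟩
    refine hec.mem_maxIdeal_pow_of_ray Set.infinite_univ fun v _ => ?_
    have hv : ((0, v) : ℂ × ℂ) ∈ e₁.target := by
      rw [ht₁]
      simpa using! hec.zero_mem_target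
    have hqp : π (e₁.symm (0, v)) = p := by
      have h2 := h₁ _ (e₁.map_target hv)
      rw [e₁.right_inv hv] at h2
      have h3 : e₁.symm (0, v) ∈ π ⁻¹' e.source := by
        rw [hsrc]; exact Or.inl (e₁.map_target hv)
      refine e.injOn h3 hp ?_
      rw [h2, hp0]; simp
    -- `γ` crosses the exceptional curve at `(0, v)` and is mapped by `π` to the line `y = v x`
    let γ : ℂ → Y := fun t => e₁.symm (t, v)
    have hline : ContDiff ℂ ω (fun t : ℂ => ((t, v) : ℂ × ℂ)) := by fun_prop
    have hγ : ContMDiffAt 𝓘(ℂ) 𝓘(ℂ, ℂ × ℂ) ω γ 0 :=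
      ContMDiffAt.comp (0 : ℂ) (g := e₁.symm) (contMDiffAt_symm_of_mem_maximalAtlas he₁ hv)
        hline.contDiffAt.contMDiffAt
    have hle : vanishingIdealAt (π ⁻¹' {p}) (e₁.symm (0, v)) ≤ HolGerm.maxIdeal _ := by
      rintro g' ⟨f, hf, hev⟩
      rw [HolGerm.mem_maxIdeal, ← hf]
      exact hev.self_of_nhds hqp
    have hγt : Tendsto γ (𝓝 0) (𝓝 (e₁.symm (0, v))) := hγ.continuousAt
    have h4 := HolGerm.maxIdeal_pow_le_orderAlong hγt rfl hγ k
      (Ideal.pow_right_mono hle k (hg _ hqp))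
    obtain ⟨f, hf, rfl⟩ := HolGerm.exists_eq_mk g
    have h5 : HolGerm.pullback π hqp (h.contMDiff _) (HolGerm.mk f hf) =
        HolGerm.mk (f ∘ π) (ContMDiffAt.comp _ (by rwa [hqp]) (h.contMDiff _)) := rfl
    rw [h5, HolGerm.mem_orderAlong] at h4
    rw [HolGerm.mem_orderAlong]
    refine h4.congr' ?_ EventuallyEq.rfl
    have h6 : ∀ᶠ t : ℂ in 𝓝 0, ((t, v) : ℂ × ℂ) ∈ e₁.target :=
      hline.continuous.continuousAt.eventually (e₁.open_target.mem_nhds hv)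
    filter_upwards [h6] with t ht
    have h7 := h₁ _ (e₁.map_target ht)
    rw [e₁.right_inv ht] at h7
    have h8 : e₁.symm (t, v) ∈ π ⁻¹' e.source := by
      rw [hsrc]; exact Or.inl (e₁.map_target ht)
    simp only [Function.comp_apply, chartRay, γ]
    rw [← h7, e.left_inv h8]
  · intro hg q hq
    -- functions vanishing at `p` pull back to functions vanishing on the fibre of `p`
    have hle : (HolGerm.maxIdeal p).map (HolGerm.pullback π hq (h.contMDiff q)) ≤
        vanishingIdealAt (π ⁻¹' {p}) q := by
      rw [Ideal.map_le_iff_le_comap]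
      intro g' hg'
      obtain ⟨f, hf, rfl⟩ := HolGerm.exists_eq_mk g'
      refine ⟨f ∘ π, rfl, Eventually.of_forall fun z hz => ?_⟩
      rw [Function.comp_apply, show π z = p from hz]
      exact hg'
    refine Ideal.pow_right_mono hle k ?_
    rw [← Ideal.map_pow]
    exact Ideal.mem_map_of_mem _ hg

end IsBlowUp

/-! ### Extension of a valuation to the field of fractions -/

section Fractions

theorem EReal.coe_toENNReal_natCast (j : ℕ) : (((j : ℕ∞) : ℝ≥0∞) : EReal) = ((j : ℝ) : EReal) := by
  rw [ENat.toENNReal_coe]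
  exact EReal.coe_nnreal_eq_coe_real j

variable {R : Type*} [CommRing R] [IsDomain R] {μ : R → ℕ∞}

/-- The value of the extension at a fraction does not depend on the fraction. -/
theorem extendToFractions_div (hmul : ∀ f g, μ (f * g) = μ f + μ g)
    (htop : ∀ f, μ f = ⊤ ↔ f = 0) (f : R) {g : R} (hg : g ≠ 0) :
    extendToFractions (fun f => (μ f : ℝ≥0∞)) (algebraMap R (FractionRing R) f / algebraMap R _ g) =
      ((μ f : ℝ≥0∞) : EReal) - ((μ g : ℝ≥0∞) : EReal) := by
  unfold extendToFractions
  set s := IsLocalization.sec (nonZeroDivisors R)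
    (algebraMap R (FractionRing R) f / algebraMap R _ g) with hs
  have hs0 : (s.2 : R) ≠ 0 := nonZeroDivisors.ne_zero s.2.2
  have hinj := IsFractionRing.injective R (FractionRing R)
  have h1 : f * s.2 = s.1 * g := by
    have h2 := IsLocalization.sec_spec (nonZeroDivisors R)
      (algebraMap R (FractionRing R) f / algebraMap R _ g)
    rw [← hs, div_mul_eq_mul_div, div_eq_iff
      (by simpa using (map_ne_zero_iff _ hinj).2 hg)] at h2
    exact hinj (by simpa using h2)
  have h3 : μ f + μ s.2 = μ s.1 + μ g := by rw [← hmul, ← hmul, h1]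
  obtain ⟨a, ha⟩ := ENat.ne_top_iff_exists.1 (mt (htop _).1 hg)
  obtain ⟨b, hb⟩ := ENat.ne_top_iff_exists.1 (mt (htop _).1 hs0)
  show (((μ s.1 : ℕ∞) : ℝ≥0∞) : EReal) - ((μ s.2 : ℝ≥0∞) : EReal) = _
  rw [← ha, ← hb] at h3 ⊢
  induction hf : μ f with
  | top =>
    have hs1 : μ s.1 = ⊤ := by
      rw [hf, top_add] at h3
      exact (ENat.add_eq_top.1 h3.symm).resolve_right (ENat.natCast_ne_top a)
    rw [hs1, EReal.coe_toENNReal_natCast, EReal.coe_toENNReal_natCast]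
    rfl
  | coe n =>
    induction hs1 : μ s.1 with
    | top =>
      rw [hf, hs1, top_add, ← Nat.cast_add] at h3
      exact absurd h3 (ENat.natCast_ne_top _)
    | coe m =>
      rw [hf, hs1] at h3
      have h4 : n + b = m + a := by exact_mod_cast h3
      have h5 : (n : ℝ) + b = m + a := by exact_mod_cast h4
      have h6 : ((m : ℝ) - b) = n - a := by linarith
      simp only [EReal.coe_toENNReal_natCast, ← EReal.coe_sub, h6]

end Fractions

section Valuation

variable {M : Type*} [TopologicalSpace M] [ChartedSpace (ℂ × ℂ) M] {q : M}

/-- A valuation on the local algebra, given by its laws on germs, extends to a dominating valuation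
of the field of fractions. -/
theorem isDominatingValuation_extendToFractions {μ : HolGerm q → ℕ∞}
    (hmul : ∀ f g, μ (f * g) = μ f + μ g) (htop : ∀ f, μ f = ⊤ ↔ f = 0)
    (hadd : ∀ f g, min (μ f) (μ g) ≤ μ (f + g))
    (hconst : ∀ r, r ≠ 0 → μ (HolGerm.const q r) = 0)
    (hpos : ∀ f ∈ HolGerm.maxIdeal q, 0 < μ f) :
    IsDominatingValuation (extendToFractions fun f => (μ f : ℝ≥0∞)) := by
  have h10 : μ 1 = 0 := hconst 1 one_ne_zero
  have : Nontrivial (HolGerm q) := ⟨1, 0, fun h => by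
    rw [← htop, h10] at h; exact absurd h (by simp)⟩
  have : NoZeroDivisors (HolGerm q) := ⟨fun {f g} h => by
    rw [← htop, hmul, ENat.add_eq_top, htop, htop] at h; exact h⟩
  have : IsDomain (HolGerm q) := NoZeroDivisors.to_isDomain _
  set ν := extendToFractions fun f => (μ f : ℝ≥0∞) with hν
  have hdiv := fun f (g : HolGerm q) (hg : g ≠ 0) => extendToFractions_div hmul htop f hg
  have halg : ∀ f, ν (algebraMap _ _ f) = ((μ f : ℝ≥0∞) : EReal) := by
    intro f
    have := hdiv f 1 one_ne_zero
    simpa [h10] using this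
  have hzero : ν 0 = ⊤ := by
    have := halg 0
    rwa [map_zero, (htop 0).2 rfl] at this
  have hfin : ∀ f, f ≠ 0 → ∃ n : ℕ, μ f = n := fun f hf =>
    (ENat.ne_top_iff_exists.1 (mt (htop f).1 hf)).imp fun _ h => h.symm
  have hfrac : ∀ x : MerGerm q, x ≠ 0 → ∃ f g : HolGerm q, f ≠ 0 ∧ g ≠ 0 ∧
      x = algebraMap _ _ f / algebraMap _ _ g := by
    intro x hx
    obtain ⟨f, g, hg, rfl⟩ := IsFractionRing.div_surjective (A := HolGerm q) x
    refine ⟨f, g, ?_, nonZeroDivisors.ne_zero hg, rfl⟩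
    rintro rfl
    simp at hx
  have hbot : ∀ x, ν x ≠ ⊥ := by
    intro x
    by_cases hx : x = 0
    · rw [hx, hzero]; exact top_ne_bot
    · obtain ⟨f, g, hf, hg, rfl⟩ := hfrac x hx
      obtain ⟨m, hm⟩ := hfin f hf
      obtain ⟨n, hn⟩ := hfin g hg
      rw [hν, hdiv f g hg, hm, hn, EReal.coe_toENNReal_natCast,
        EReal.coe_toENNReal_natCast, ← EReal.coe_sub]
      exact EReal.coe_ne_bot _
  refine ⟨hbot, ?_, ?_, hzero, ?_, ?_, ?_⟩
  · intro x y
    by_cases hx : x = 0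
    · rw [hx, zero_mul, hzero, EReal.top_add_of_ne_bot (hbot y)]
    by_cases hy : y = 0
    · rw [hy, mul_zero, hzero, EReal.add_top_of_ne_bot (hbot x)]
    obtain ⟨f, g, hf, hg, rfl⟩ := hfrac x hx
    obtain ⟨f', g', hf', hg', rfl⟩ := hfrac y hy
    obtain ⟨m, hm⟩ := hfin f hf
    obtain ⟨n, hn⟩ := hfin g hg
    obtain ⟨m', hm'⟩ := hfin f' hf'
    obtain ⟨n', hn'⟩ := hfin g' hg'
    rw [div_mul_div_comm, ← map_mul, ← map_mul, hν, hdiv _ _ (mul_ne_zero hg hg'), hdiv _ _ hg,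
      hdiv _ _ hg', hmul, hmul, hm, hn, hm', hn', ← Nat.cast_add, ← Nat.cast_add]
    simp only [EReal.coe_toENNReal_natCast, ← EReal.coe_sub, ← EReal.coe_add]
    rw [EReal.coe_eq_coe_iff]
    push_cast
    ring
  · intro x y
    by_cases hx : x = 0
    · rw [hx, zero_add]; exact min_le_right _ _
    by_cases hy : y = 0
    · rw [hy, add_zero]; exact min_le_left _ _
    by_cases hxy : x + y = 0
    · rw [hxy, hzero]; exact le_top
    obtain ⟨f, g, hf, hg, rfl⟩ := hfrac x hx
    obtain ⟨f', g', hf', hg', rfl⟩ := hfrac y hy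
    have hinj := IsFractionRing.injective (HolGerm q) (MerGerm q)
    have hga : algebraMap (HolGerm q) (MerGerm q) g ≠ 0 := (map_ne_zero_iff _ hinj).2 hg
    have hga' : algebraMap (HolGerm q) (MerGerm q) g' ≠ 0 := (map_ne_zero_iff _ hinj).2 hg'
    have hsum : algebraMap (HolGerm q) (MerGerm q) f / algebraMap _ _ g +
        algebraMap _ _ f' / algebraMap _ _ g' =
        algebraMap _ _ (f * g' + g * f') / algebraMap _ _ (g * g') := by
      rw [div_add_div _ _ hga hga']; simp
    rw [hsum] at hxy ⊢
    have hs0 : f * g' + g * f' ≠ 0 := by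
      intro h; rw [h] at hxy; simp at hxy
    obtain ⟨m, hm⟩ := hfin f hf
    obtain ⟨n, hn⟩ := hfin g hg
    obtain ⟨m', hm'⟩ := hfin f' hf'
    obtain ⟨n', hn'⟩ := hfin g' hg'
    obtain ⟨l, hl⟩ := hfin _ hs0
    have hle := hadd (f * g') (g * f')
    rw [hl, hmul, hmul, hm, hn, hm', hn'] at hle
    rw [hν, hdiv _ _ (mul_ne_zero hg hg'), hdiv _ _ hg, hdiv _ _ hg', hmul, hl, hm, hn, hm', hn',
      ← Nat.cast_add]
    simp only [EReal.coe_toENNReal_natCast, ← EReal.coe_sub]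
    rw [min_le_iff, EReal.coe_le_coe_iff, EReal.coe_le_coe_iff]
    push_cast
    rcases min_le_iff.1 hle with h | h
    · left
      have : (m : ℝ) + n' ≤ l := by exact_mod_cast h
      linarith
    · right
      have : (n : ℝ) + m' ≤ l := by exact_mod_cast h
      linarith
  · intro r hr
    rw [halg, hconst r hr]; simp
  · intro f
    rw [halg]
    exact EReal.coe_ennreal_nonneg _
  · intro f hf
    rw [halg, EReal.coe_ennreal_pos]
    exact (by simpa using ENat.toENNReal_lt.2 (hpos f hf))

end Valuation

/-! ### The divisorial valuation as a multiplicity -/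

namespace BlowUpSequence

variable {X : ℕ → Type*} [∀ i, TopologicalSpace (X i)] [∀ i, ChartedSpace (ℂ × ℂ) (X i)]
  (T : BlowUpSequence X)

/-- A holomorphic function on `X 0` vanishes if its pull-back to the `m`-th model does. -/
theorem eventually_eq_zero_of_proj [∀ i, IsManifold 𝓘(ℂ, ℂ × ℂ) ω (X i)]
    [∀ i, T1Space (X i)] {m : ℕ} (hm : m ≤ T.length) (q : X m)
    {F : X 0 → ℂ} (hF : ContMDiffAt 𝓘(ℂ, ℂ × ℂ) 𝓘(ℂ) ω F (T.proj m q))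
    (hz : ∀ᶠ z in 𝓝 q, F (T.proj m z) = 0) : ∀ᶠ x in 𝓝 (T.proj m q), F x = 0 := by
  induction m with
  | zero => simpa [T.proj_zero] using hz
  | succ m ih =>
    simp only [T.proj_succ, Function.comp_apply] at hF hz ⊢
    refine ih (by omega) (T.π m q) hF ?_
    exact (T.isBlowUp m hm).eventually_eq_zero
      (ContMDiffAt.comp _ hF (T.contMDiff_proj m (by omega) _)) hz

theorem pullback_eq_zero_iff [∀ i, IsManifold 𝓘(ℂ, ℂ × ℂ) ω (X i)]
    [∀ i, T1Space (X i)] {m : ℕ} (hm : m ≤ T.length) {q : X m}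
    (hq : T.proj m q = T.p 0) {f : HolGerm (T.p 0)} : T.pullback hm hq f = 0 ↔ f = 0 := by
  refine ⟨fun h => ?_, fun h => by rw [h, map_zero]⟩
  obtain ⟨F, hF, rfl⟩ := HolGerm.exists_eq_mk f
  have h1 : ((F ∘ T.proj m : X m → ℂ) : Germ (𝓝 q) ℂ) = (0 : X m → ℂ) :=
    congr_arg Subtype.val h
  have h2 := T.eventually_eq_zero_of_proj hm q (by rwa [hq]) (Germ.coe_eq.1 h1)
  rw [hq] at h2
  exact Subtype.ext (Germ.coe_eq.2 h2)

theorem pullback_succ {m : ℕ} (hm : m < T.length) {q : X (m + 1)} {P : X m} (hP : T.π m q = P)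
    (hq : T.proj (m + 1) q = T.p 0) (hq' : T.proj m P = T.p 0) (f : HolGerm (T.p 0)) :
    T.pullback hm hq f = HolGerm.pullback (T.π m) hP ((T.isBlowUp m hm).contMDiff q)
      (T.pullback hm.le hq' f) := by
  obtain ⟨F, hF, rfl⟩ := HolGerm.exists_eq_mk f
  refine Subtype.ext (Germ.coe_eq.2 (Eventually.of_forall fun z => ?_))
  show F (T.proj (m + 1) z) = F (T.proj m (T.π m z))
  rw [T.proj_succ]; rfl

/-- The exceptional curve which has just been created is the fibre above the blown-up point. -/
theorem E_succ_self (m : ℕ) : T.E m (m + 1) = T.π m ⁻¹' {T.p m} := by simp [E]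

/-- The order of vanishing along the exceptional curve created by the blow-up of `p a` is the
multiplicity of the pull-back at `p a`. -/
theorem order_eq_germMult [∀ i, IsManifold 𝓘(ℂ, ℂ × ℂ) ω (X i)]
    {a : ℕ} (ha : a < T.length) (f : HolGerm (T.p 0)) :
    T.order ha f = germMult (T.pullback ha.le (T.proj_p a ha) f) := by
  unfold order germMult
  refine iSup_congr fun k => iSup_congr_Prop ?_ fun _ => rfl
  rw [← (T.isBlowUp a ha).forall_pullback_mem_iff]
  have hE := T.E_succ_self a
  constructor
  · intro h q hq
    have := h q (hE ▸ hq)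
    rwa [T.pullback_succ ha hq _ (T.proj_p a ha), hE] at this
  · intro h q hq
    have hq' : T.π a q = T.p a := by rwa [hE] at hq
    have := h q hq'
    rwa [T.pullback_succ ha hq' _ (T.proj_p a ha), hE]

theorem isDominatingValuation_divisorialValuation [∀ i, IsManifold 𝓘(ℂ, ℂ × ℂ) ω (X i)]
    [∀ i, T1Space (X i)] {a : ℕ}
    (ha : a < T.length) : IsDominatingValuation (T.divisorialValuation ha) := by
  obtain ⟨e, he⟩ := exists_isCentredChart (T.p a)
  refine isDominatingValuation_extendToFractions ?_ ?_ ?_ ?_ ?_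
  · intro f g
    rw [order_eq_germMult, order_eq_germMult, order_eq_germMult, map_mul, he.mult_mul]
  · intro f
    rw [order_eq_germMult, he.mult_eq_top_iff, pullback_eq_zero_iff]
  · intro f g
    rw [order_eq_germMult, order_eq_germMult, order_eq_germMult, map_add]
    exact HolGerm.min_le_mult_add _ _
  · intro r hr
    rw [order_eq_germMult]
    exact HolGerm.mult_const hr
  · intro f hf
    rw [order_eq_germMult, ← Order.one_le_iff_pos, ← Nat.cast_one, HolGerm.le_mult_iff, pow_one]
    obtain ⟨F, hF, rfl⟩ := HolGerm.exists_eq_mk f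
    show F (T.proj a (T.p a)) = 0
    rw [T.proj_p a ha]
    exact hf

/-- Any centred coordinates at `p a` will do, whatever the position of the exceptional divisor. -/
theorem divisorialValuation_eq_monomialValuation [∀ i, IsManifold 𝓘(ℂ, ℂ × ℂ) ω (X i)]
    {a : ℕ} (ha : a < T.length)
    {e : OpenPartialHomeomorph (X a) (ℂ × ℂ)} (he : IsCentredChart e (T.p a)) :
    T.divisorialValuation ha = T.monomialValuation ha e 1 1 := by
  unfold divisorialValuation monomialValuation
  congr 1
  funext f
  rw [order_eq_germMult, he.monomialOrder_one_one]

end BlowUpSequence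

/-! ### Strict transforms and normal crossings -/

namespace IsBlowUp

variable {X Y : Type*} [TopologicalSpace X] [ChartedSpace (ℂ × ℂ) X]
  [TopologicalSpace Y] [ChartedSpace (ℂ × ℂ) Y] {π : Y → X} {p : X}

/-- The pull-back of a function vanishing at the centre is divisible by the equation of the
exceptional curve; the quotient `g` is computed to first order from the linear part `D` of the
function. -/
theorem exists_pullback_eq_mul (h : IsBlowUp π p) {q : Y} (hq : π q = p)
    {e : OpenPartialHomeomorph X (ℂ × ℂ)} {ψ : OpenPartialHomeomorph Y (ℂ × ℂ)}
    (he : IsCentredChart e p)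
    (hev : ∀ᶠ y in 𝓝 q, e (π y) = ((ψ y).1, (ψ y).1 * (ψ y).2)) {f : X → ℂ}
    (hf : ContMDiffAt 𝓘(ℂ, ℂ × ℂ) 𝓘(ℂ) ω f p) (hf0 : f p = 0) {D : ℂ × ℂ →L[ℂ] ℂ}
    (hD : HasFDerivAt (f ∘ e.symm) D 0) :
    ∃ g : ℂ × ℂ → ℂ, AnalyticAt ℂ g 0 ∧ (∀ᶠ y in 𝓝 q, f (π y) = (ψ y).1 * g (ψ y)) ∧
      g 0 = D (1, 0) ∧ fderiv ℂ g 0 (0, 1) = D (0, 1) := by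
  obtain ⟨H, hH, hev'⟩ := (he.analyticAt_comp_symm hf).exists_eq_add_apply_self
  have h0 : (f ∘ e.symm) 0 = 0 := by simp [he.symm_zero, hf0]
  have hHD : H 0 = D := by
    have h1 : HasFDerivAt (fun w => H w w) (H 0) 0 := by
      have := hH.differentiableAt.hasFDerivAt.clm_apply (hasFDerivAt_id (0 : ℂ × ℂ))
      have h2 : (H 0).comp (ContinuousLinearMap.id ℂ (ℂ × ℂ)) + (fderiv ℂ H 0).flip (id 0) =
          H 0 := by
        ext <;> simp
      rw [h2] at this
      exact this
    refine HasFDerivAt.unique (h1.congr_of_eventuallyEq ?_) hD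
    filter_upwards [hev'] with w hw
    rw [hw, h0, zero_add]
  -- `f (u, u v) = H (u, u v) (u, u v) = u * H (u, u v) (1, v)`
  let g : ℂ × ℂ → ℂ := fun w => H (w.1, w.1 * w.2) (1, w.2)
  have hg : ContDiffAt ℂ ω g 0 := by
    refine ContDiffAt.clm_apply (ContDiffAt.comp (0 : ℂ × ℂ) (g := H)
      (f := fun w : ℂ × ℂ => ((w.1, w.1 * w.2) : ℂ × ℂ)) ?_ (by fun_prop)) (by fun_prop)
    simpa using! hH.contDiffAt
  refine ⟨g, hg.analyticAt, ?_, ?_, ?_⟩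
  · filter_upwards [hev, (h.tendsto hq).eventually he.eventually_left_inv,
      ((he.tendsto.comp (h.tendsto hq))).eventually hev'] with y h1 h2 h3
    have h4 : (f ∘ e.symm) (e (π y)) = f (π y) := by simp [h2]
    simp only [Function.comp_apply] at h3
    rw [h2, he.symm_zero, hf0, zero_add, h1] at h3
    rw [h3]
    have h5 : (((ψ y).1, (ψ y).1 * (ψ y).2) : ℂ × ℂ) = (ψ y).1 • (1, (ψ y).2) := by
      ext <;> simp
    conv_lhs => rw [h5, map_smul, ← h5]
    rfl
  · simp only [g, ← hHD, Prod.fst_zero, Prod.snd_zero, mul_zero]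
    rfl
  · have h1 : HasDerivAt (fun t : ℂ => ((0, t) : ℂ × ℂ)) ((0, 1) : ℂ × ℂ) 0 :=
      (hasDerivAt_const _ _).prodMk (hasDerivAt_id _)
    have h2 : HasFDerivAt g (fderiv ℂ g 0) ((fun t : ℂ => ((0, t) : ℂ × ℂ)) 0) :=
      (hg.differentiableAt (by simp)).hasFDerivAt
    have h3 := h2.comp_hasDerivAt (0 : ℂ) h1
    have h4 : HasDerivAt (g ∘ fun t : ℂ => ((0, t) : ℂ × ℂ)) (D (0, 1)) 0 := by
      have h5 : (g ∘ fun t : ℂ => ((0, t) : ℂ × ℂ)) = fun t => D (1, 0) + t * D (0, 1) := by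
        funext t
        have : ((1, t) : ℂ × ℂ) = (1, 0) + t • (0, 1) := by ext <;> simp
        simp only [g, Function.comp_apply, zero_mul, ← hHD]
        rw [this, map_add, map_smul]
        rfl
      rw [h5]
      simpa using ((hasDerivAt_id (0 : ℂ)).mul_const (D (0, 1))).const_add (D (1, 0))
    exact h3.unique h4

/-- At a point of the strict transform of a curve `f = 0` lying on the exceptional curve, the
quotient of the pull-back of `f` by the equation of the exceptional curve vanishes. -/
theorem quotient_eq_zero (h : IsBlowUp π p) {q : Y} (hq : π q = p)
    {e : OpenPartialHomeomorph X (ℂ × ℂ)} {ψ : OpenPartialHomeomorph Y (ℂ × ℂ)}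
    (he : IsCentredChart e p) (hψ : IsCentredChart ψ q)
    (hev : ∀ᶠ y in 𝓝 q, e (π y) = ((ψ y).1, (ψ y).1 * (ψ y).2)) {f : X → ℂ} {Z : Set X}
    (hZ : ∀ᶠ x in 𝓝 p, x ∈ Z → f x = 0) {g : ℂ × ℂ → ℂ} (hg : AnalyticAt ℂ g 0)
    (hgev : ∀ᶠ y in 𝓝 q, f (π y) = (ψ y).1 * g (ψ y))
    (hqZ : q ∈ closure (π ⁻¹' (Z \ {p}))) : g 0 = 0 := by
  have h1 : ∃ᶠ y in 𝓝 q, g (ψ y) = 0 := by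
    refine ((mem_closure_iff_frequently.1 hqZ).and_eventually (hgev.and
      (((h.tendsto hq).eventually hZ).and (h.eventually_mem_fibre_iff hq he hev)))).mono ?_
    rintro y ⟨⟨hyZ, hyp⟩, h2, h3, h4⟩
    rw [h3 hyZ] at h2
    exact (mul_eq_zero.1 h2.symm).resolve_left (mt h4.2 hyp)
  have h2 : Tendsto (fun y => g (ψ y)) (𝓝 q) (𝓝 (g 0)) := hg.continuousAt.tendsto.comp hψ.tendsto
  have h3 : IsClosed ({0} : Set ℂ) := isClosed_singleton
  exact h3.mem_of_frequently_of_tendsto h1 h2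

/-- The strict transform of a smooth curve through the centre is transversal to the exceptional
curve. -/
theorem exists_chart_exceptional_strict [IsManifold 𝓘(ℂ, ℂ × ℂ) ω X]
    [IsManifold 𝓘(ℂ, ℂ × ℂ) ω Y] (h : IsBlowUp π p) {q : Y} (hq : π q = p)
    {φ : OpenPartialHomeomorph X (ℂ × ℂ)} (hφ : IsCentredChart φ p) {Z : Set X}
    (hZ : ∀ᶠ x in 𝓝 p, x ∈ Z ↔ (φ x).1 = 0) (hqZ : q ∈ closure (π ⁻¹' (Z \ {p}))) :
    ∃ ψ : OpenPartialHomeomorph Y (ℂ × ℂ), IsCentredChart ψ q ∧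
      (∀ᶠ y in 𝓝 q, y ∈ π ⁻¹' {p} ↔ (ψ y).1 = 0) ∧
      ∀ᶠ y in 𝓝 q, y ∈ closure (π ⁻¹' (Z \ {p})) ↔ (ψ y).2 = 0 := by
  obtain ⟨e, ψ, he, hψ, hev⟩ := h.exists_charts hq
  obtain ⟨L, hL⟩ := he.exists_hasFDerivAt hφ
  let D : ℂ × ℂ →L[ℂ] ℂ := (ContinuousLinearMap.fst ℂ ℂ ℂ).comp (L : (ℂ × ℂ) →L[ℂ] (ℂ × ℂ))
  have hD : HasFDerivAt ((Prod.fst ∘ φ) ∘ e.symm) D 0 := hL.fst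
  obtain ⟨g, hg, hgev, hg0, hg1⟩ := h.exists_pullback_eq_mul hq he hev
    (hφ.contMDiffAt_comp analyticAt_fst) (by simp [hφ.centred]) hD
  have hg0' : g 0 = 0 :=
    h.quotient_eq_zero hq he hψ hev (hZ.mono fun x hx => hx.1) hg hgev hqZ
  have hD1 : D (0, 1) ≠ 0 := by
    intro h1
    rw [hg0'] at hg0
    have h2 : ∀ w, D w = 0 := by
      intro w
      have : w = w.1 • ((1, 0) : ℂ × ℂ) + w.2 • ((0, 1) : ℂ × ℂ) := by ext <;> simp
      rw [this, map_add, map_smul, map_smul, h1, ← hg0]; simp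
    have h3 := h2 (L.symm (1, 0))
    simp [D] at h3
  -- the new coordinates are `(u, g)`
  let Λ : (ℂ × ℂ) →L[ℂ] (ℂ × ℂ) := (ContinuousLinearMap.fst ℂ ℂ ℂ).prod (fderiv ℂ g 0)
  have hΛ : Function.Injective Λ := by
    rw [injective_iff_map_eq_zero]
    rintro ⟨x, y⟩ hxy
    have hx : x = 0 := congr_arg Prod.fst hxy
    subst hx
    have hy : fderiv ℂ g 0 (0, y) = 0 := congr_arg Prod.snd hxy
    have h1 : ((0, y) : ℂ × ℂ) = y • (0, 1) := by ext <;> simp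
    rw [h1, map_smul, hg1, smul_eq_mul, mul_eq_zero] at hy
    rw [hy.resolve_right hD1]; rfl
  let Λ' : (ℂ × ℂ) ≃L[ℂ] (ℂ × ℂ) :=
    (LinearEquiv.ofInjectiveEndo (Λ : (ℂ × ℂ) →ₗ[ℂ] (ℂ × ℂ)) hΛ).toContinuousLinearEquiv
  have hΛ' : (Λ' : (ℂ × ℂ) →L[ℂ] (ℂ × ℂ)) = Λ := by ext <;> rfl
  obtain ⟨χ, hχ, hχev⟩ := exists_centredChart_of_comp hψ.mem_atlas hψ.mem_source
    (Φ := fun w => (w.1, g w)) (L := Λ')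
    (by rw [hψ.centred]; exact contDiffAt_fst.prodMk hg.contDiffAt)
    (by rw [hψ.centred, hΛ']; exact hasFDerivAt_fst.prodMk hg.differentiableAt.hasFDerivAt)
    (by rw [hψ.centred, hg0']; rfl)
  have hfib := h.eventually_mem_fibre_iff hq he hev
  refine ⟨χ, hχ, ?_, ?_⟩
  · filter_upwards [hχev, hfib] with y h1 h2
    rw [h1]; exact h2
  have hS : ∀ᶠ y in 𝓝 q, y ∈ π ⁻¹' (Z \ {p}) ↔ (χ y).1 ≠ 0 ∧ (χ y).2 = 0 := by
    filter_upwards [hχev, hfib, hgev, (h.tendsto hq).eventually hZ] with y h1 h2 h3 h4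
    rw [h1]
    simp only [Function.comp_apply] at h3
    rw [Set.mem_preimage, Set.mem_sdiff, Set.mem_singleton_iff, h2, h4, h3, mul_eq_zero]
    tauto
  filter_upwards [hS.eventually_nhds, χ.open_source.mem_nhds hχ.mem_source] with y hy hyχ
  rw [mem_closure_iff_frequently]
  constructor
  · intro h1
    have h2 : Tendsto (fun z => (χ z).2) (𝓝 y) (𝓝 (χ y).2) :=
      (continuous_snd.tendsto _).comp (χ.continuousAt hyχ)
    exact isClosed_singleton.mem_of_frequently_of_tendsto
      ((h1.and_eventually hy).mono fun z hz => (hz.2.1 hz.1).2) h2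
  · -- a point of `g = 0` is a limit of points of `g = 0` with `u ≠ 0`
    intro h1
    let c : ℂ → ℂ × ℂ := fun t => (t, 0)
    have hc : Tendsto c (𝓝[≠] (χ y).1) (𝓝 (χ y)) := by
      have : Continuous c := by fun_prop
      exact (this.tendsto' _ _ (by simp [c, ← h1])).mono_left nhdsWithin_le_nhds
    have h2 : Tendsto (fun t => χ.symm (c t)) (𝓝[≠] (χ y).1) (𝓝 y) := by
      have := (χ.continuousAt_symm (χ.map_source hyχ)).tendsto
      rw [χ.left_inv hyχ] at this
      exact this.comp hc
    have hne : ∀ᶠ t in 𝓝[≠] (χ y).1, t ≠ 0 := by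
      by_cases h3 : (χ y).1 = 0
      · rw [h3]; exact self_mem_nhdsWithin
      · exact nhdsWithin_le_nhds (isOpen_ne.mem_nhds h3)
    have h3 : ∀ᶠ t in 𝓝[≠] (χ y).1, χ.symm (c t) ∈ π ⁻¹' (Z \ {p}) := by
      filter_upwards [h2.eventually hy, hne,
        hc.eventually (χ.open_target.mem_nhds (χ.map_source hyχ))] with t h4 h5 h6
      rw [h4, χ.right_inv h6]
      exact ⟨h5, rfl⟩
    exact h2.frequently h3.frequently

/-- The strict transforms of two transversal smooth curves do not meet on the exceptional curve. -/
theorem not_mem_closure_of_transversal [IsManifold 𝓘(ℂ, ℂ × ℂ) ω X]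
    [IsManifold 𝓘(ℂ, ℂ × ℂ) ω Y] (h : IsBlowUp π p) {q : Y} (hq : π q = p)
    {φ : OpenPartialHomeomorph X (ℂ × ℂ)} (hφ : IsCentredChart φ p) {Z W : Set X}
    (hZ : ∀ᶠ x in 𝓝 p, x ∈ Z ↔ (φ x).1 = 0) (hW : ∀ᶠ x in 𝓝 p, x ∈ W ↔ (φ x).2 = 0)
    (hqZ : q ∈ closure (π ⁻¹' (Z \ {p}))) : q ∉ closure (π ⁻¹' (W \ {p})) := by
  intro hqW
  obtain ⟨e, ψ, he, hψ, hev⟩ := h.exists_charts hq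
  obtain ⟨L, hL⟩ := he.exists_hasFDerivAt hφ
  have hD₁ : HasFDerivAt ((Prod.fst ∘ φ) ∘ e.symm) ((ContinuousLinearMap.fst ℂ ℂ ℂ).comp
    (L : (ℂ × ℂ) →L[ℂ] (ℂ × ℂ))) 0 := hL.fst
  have hD₂ : HasFDerivAt ((Prod.snd ∘ φ) ∘ e.symm) ((ContinuousLinearMap.snd ℂ ℂ ℂ).comp
    (L : (ℂ × ℂ) →L[ℂ] (ℂ × ℂ))) 0 := hL.snd
  obtain ⟨g₁, hg₁, hgev₁, hg₁0, -⟩ := h.exists_pullback_eq_mul hq he hev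
    (hφ.contMDiffAt_comp analyticAt_fst) (by simp [hφ.centred]) hD₁
  obtain ⟨g₂, hg₂, hgev₂, hg₂0, -⟩ := h.exists_pullback_eq_mul hq he hev
    (hφ.contMDiffAt_comp analyticAt_snd) (by simp [hφ.centred]) hD₂
  have h₁ := h.quotient_eq_zero hq he hψ hev (hZ.mono fun x hx => hx.1) hg₁ hgev₁ hqZ
  have h₂ := h.quotient_eq_zero hq he hψ hev (hW.mono fun x hx => hx.1) hg₂ hgev₂ hqW
  have h3 : L (1, 0) = 0 := Prod.ext (hg₁0.symm.trans h₁) (hg₂0.symm.trans h₂)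
  rw [map_eq_zero_iff _ L.injective] at h3
  simp at h3

/-- Away from the exceptional curve, charts are lifted through the blow-up. -/
theorem exists_chart_of_ne [T1Space X] [IsManifold 𝓘(ℂ, ℂ × ℂ) ω Y] (h : IsBlowUp π p) {q : Y}
    (hq : π q ≠ p) {φ : OpenPartialHomeomorph X (ℂ × ℂ)} (hφ : IsCentredChart φ (π q)) :
    ∃ ψ : OpenPartialHomeomorph Y (ℂ × ℂ), IsCentredChart ψ q ∧ ∀ y, ψ y = φ (π y) := by
  obtain ⟨s, hs, hs1, hs2⟩ := h.iso_away
  let σ : OpenPartialHomeomorph Y X :=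
    { toFun := π
      invFun := s
      source := π ⁻¹' {p}ᶜ
      target := {p}ᶜ
      map_source' := fun y hy => hy
      map_target' := fun x hx => by rw [Set.mem_preimage, hs1 x hx]; exact hx
      left_inv' := fun y hy => hs2 y hy
      right_inv' := fun x hx => hs1 x hx
      open_source := isOpen_compl_singleton.preimage h.contMDiff.continuous
      open_target := isOpen_compl_singleton
      continuousOn_toFun := h.contMDiff.continuous.continuousOn
      continuousOn_invFun := hs.continuousOn }
  have hqs : q ∈ (σ.trans φ).source := by
    rw [OpenPartialHomeomorph.trans_source]
    exact ⟨hq, hφ.mem_source⟩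
  refine ⟨σ.trans φ, ⟨OpenPartialHomeomorph.mem_maximalAtlas_of_contMDiffOn _ ?_ ?_, hqs,
    hφ.centred⟩, fun y => rfl⟩
  · rw [OpenPartialHomeomorph.coe_trans, OpenPartialHomeomorph.trans_source]
    exact (contMDiffOn_of_mem_maximalAtlas hφ.mem_atlas).comp h.contMDiff.contMDiffOn
      (fun _ hz => hz.2)
  · rw [OpenPartialHomeomorph.coe_trans_symm, OpenPartialHomeomorph.trans_target]
    exact hs.comp ((contMDiffOn_symm_of_mem_maximalAtlas hφ.mem_atlas).mono (by simp))
      (fun z hz => hz.2)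

theorem mem_closure_iff_of_ne [T1Space X] (h : IsBlowUp π p) {Z : Set X} (hZ : IsClosed Z) {y : Y}
    (hy : π y ≠ p) : y ∈ closure (π ⁻¹' (Z \ {p})) ↔ π y ∈ Z := by
  refine ⟨fun h1 => ?_, fun h1 => subset_closure ⟨h1, hy⟩⟩
  exact closure_minimal (fun _ hz => hz.1) (hZ.preimage h.contMDiff.continuous) h1

theorem mem_of_mem_closure (h : IsBlowUp π p) {Z : Set X} (hZ : IsClosed Z) {y : Y}
    (hy : y ∈ closure (π ⁻¹' (Z \ {p}))) : π y ∈ Z :=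
  closure_minimal (fun _ hz => hz.1) (hZ.preimage h.contMDiff.continuous) hy

end IsBlowUp

namespace BlowUpSequence

variable {X : ℕ → Type*} [∀ i, TopologicalSpace (X i)] [∀ i, ChartedSpace (ℂ × ℂ) (X i)]
  (T : BlowUpSequence X)

theorem E_succ_of_ne {i m : ℕ} (h : m ≠ i) :
    T.E i (m + 1) = closure (T.π m ⁻¹' (T.E i m \ {T.p m})) := by simp [E, h]

theorem isClosed_E [∀ i, T1Space (X i)] (i : ℕ) {m : ℕ} (hm : m ≤ T.length) :
    IsClosed (T.E i m) := by
  cases m with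
  | zero => exact isClosed_empty
  | succ m =>
    by_cases h : m = i
    · subst h
      rw [E_succ_self]
      exact isClosed_singleton.preimage (T.isBlowUp m hm).contMDiff.continuous
    · rw [T.E_succ_of_ne h]
      exact isClosed_closure

theorem E_eq_empty {i m : ℕ} (h : m ≤ i) : T.E i m = ∅ := by
  induction m with
  | zero => rfl
  | succ m ih => simp [T.E_succ_of_ne (show m ≠ i by omega), ih (by omega)]

theorem mem_E_succ_iff_of_ne [∀ i, T1Space (X i)] (i : ℕ) {m : ℕ} (hm : m < T.length)
    {y : X (m + 1)} (hy : T.π m y ≠ T.p m) : y ∈ T.E i (m + 1) ↔ T.π m y ∈ T.E i m := by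
  by_cases h : m = i
  · subst h
    rw [E_succ_self, T.E_eq_empty le_rfl]
    exact iff_of_false hy (Set.notMem_empty _)
  · rw [T.E_succ_of_ne h]
    exact (T.isBlowUp m hm).mem_closure_iff_of_ne (T.isClosed_E i hm.le) hy

theorem eventually_mem_E_succ_iff [∀ i, T1Space (X i)] (i : ℕ) {m : ℕ} (hm : m < T.length)
    {q : X (m + 1)} (hq : T.π m q ≠ T.p m) {P : X m → Prop}
    (h : ∀ᶠ x in 𝓝 (T.π m q), x ∈ T.E i m ↔ P x) :
    ∀ᶠ y in 𝓝 q, y ∈ T.E i (m + 1) ↔ P (T.π m y) := by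
  have hπ := (T.isBlowUp m hm).contMDiff.continuous
  filter_upwards [hπ.continuousAt.eventually h,
    hπ.continuousAt.eventually (isOpen_compl_singleton.mem_nhds hq)] with y h1 h2
  rw [T.mem_E_succ_iff_of_ne i hm h2, h1]

/-- The components of the exceptional divisor are smooth curves. -/
theorem exists_chart_E [∀ i, T1Space (X i)] [∀ i, IsManifold 𝓘(ℂ, ℂ × ℂ) ω (X i)] (i : ℕ)
    {m : ℕ} (hm : m ≤ T.length) {q : X m} (hq : q ∈ T.E i m) :
    ∃ e, IsCentredChart e q ∧ ∀ᶠ z in 𝓝 q, z ∈ T.E i m ↔ (e z).1 = 0 := by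
  induction m with
  | zero => exact absurd hq (Set.notMem_empty q)
  | succ m ih =>
    have hb := T.isBlowUp m hm
    by_cases hp : T.π m q = T.p m
    · by_cases h : m = i
      · subst h
        obtain ⟨e, ψ, he, hψ, hev⟩ := hb.exists_charts hp
        refine ⟨ψ, hψ, ?_⟩
        rw [E_succ_self]
        exact hb.eventually_mem_fibre_iff hp he hev
      · rw [T.E_succ_of_ne h] at hq ⊢
        have hpE := hb.mem_of_mem_closure (T.isClosed_E i (by omega)) hq
        rw [hp] at hpE
        obtain ⟨φ, hφ, hφE⟩ := ih (by omega) hpE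
        obtain ⟨ψ, hψ, -, hψE⟩ := hb.exists_chart_exceptional_strict hp hφ hφE hq
        obtain ⟨ψ', hψ', hswap⟩ := hψ.exists_swap
        refine ⟨ψ', hψ', ?_⟩
        filter_upwards [hswap, hψE] with z h1 h2
        rw [h1]; exact h2
    · obtain ⟨φ, hφ, hφE⟩ := ih (by omega) ((T.mem_E_succ_iff_of_ne i hm hp).1 hq)
      obtain ⟨ψ, hψ, hψφ⟩ := hb.exists_chart_of_ne hp hφ
      refine ⟨ψ, hψ, ?_⟩
      simp only [hψφ]
      exact T.eventually_mem_E_succ_iff i hm hp hφE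

/-- The exceptional curve of the last blow-up is transversal to the other components. -/
theorem exists_chart_E_self_inter_E [∀ i, T1Space (X i)]
    [∀ i, IsManifold 𝓘(ℂ, ℂ × ℂ) ω (X i)] {j m : ℕ} (hmj : m ≠ j) (hm : m < T.length)
    {q : X (m + 1)} (hi : q ∈ T.E m (m + 1)) (hj : q ∈ T.E j (m + 1)) :
    ∃ e, IsCentredChart e q ∧ (∀ᶠ z in 𝓝 q, z ∈ T.E m (m + 1) ↔ (e z).1 = 0) ∧
      ∀ᶠ z in 𝓝 q, z ∈ T.E j (m + 1) ↔ (e z).2 = 0 := by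
  have hb := T.isBlowUp m hm
  rw [E_succ_self] at hi ⊢
  have hp : T.π m q = T.p m := hi
  rw [T.E_succ_of_ne hmj] at hj ⊢
  have hpE := hb.mem_of_mem_closure (T.isClosed_E j hm.le) hj
  rw [hp] at hpE
  obtain ⟨φ, hφ, hφE⟩ := T.exists_chart_E j hm.le hpE
  exact hb.exists_chart_exceptional_strict hp hφ hφE hj

/-- Two distinct components of the exceptional divisor meet transversally. -/
theorem exists_chart_E_inter_E [∀ i, T1Space (X i)] [∀ i, IsManifold 𝓘(ℂ, ℂ × ℂ) ω (X i)]
    {i j : ℕ} (hij : i ≠ j) {m : ℕ} (hm : m ≤ T.length) {q : X m} (hi : q ∈ T.E i m)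
    (hj : q ∈ T.E j m) :
    ∃ e, IsCentredChart e q ∧ (∀ᶠ z in 𝓝 q, z ∈ T.E i m ↔ (e z).1 = 0) ∧
      ∀ᶠ z in 𝓝 q, z ∈ T.E j m ↔ (e z).2 = 0 := by
  induction m with
  | zero => exact absurd hi (Set.notMem_empty q)
  | succ m ih =>
    have hb := T.isBlowUp m hm
    by_cases hp : T.π m q = T.p m
    · by_cases hmi : m = i
      · subst hmi
        exact T.exists_chart_E_self_inter_E hij hm hi hj
      by_cases hmj : m = j
      · subst hmj
        obtain ⟨ψ, hψ, hψj, hψi⟩ := T.exists_chart_E_self_inter_E hmi hm hj hi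
        obtain ⟨ψ', hψ', hswap⟩ := hψ.exists_swap
        refine ⟨ψ', hψ', ?_, ?_⟩
        · filter_upwards [hswap, hψi] with z h1 h2
          rw [h1]; exact h2
        · filter_upwards [hswap, hψj] with z h1 h2
          rw [h1]; exact h2
      · -- both components are strict transforms, which are separated over the centre
        rw [T.E_succ_of_ne hmi] at hi
        rw [T.E_succ_of_ne hmj] at hj
        have hpi := hb.mem_of_mem_closure (T.isClosed_E i (by omega)) hi
        have hpj := hb.mem_of_mem_closure (T.isClosed_E j (by omega)) hj
        rw [hp] at hpi hpj
        obtain ⟨φ, hφ, hφi, hφj⟩ := ih (by omega) hpi hpj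
        exact absurd hj (hb.not_mem_closure_of_transversal hp hφ hφi hφj hi)
    · obtain ⟨φ, hφ, hφi, hφj⟩ := ih (by omega) ((T.mem_E_succ_iff_of_ne i hm hp).1 hi)
        ((T.mem_E_succ_iff_of_ne j hm hp).1 hj)
      obtain ⟨ψ, hψ, hψφ⟩ := hb.exists_chart_of_ne hp hφ
      refine ⟨ψ, hψ, ?_, ?_⟩
      · simp only [hψφ]
        exact T.eventually_mem_E_succ_iff i hm hp hφi
      · simp only [hψφ]
        exact T.eventually_mem_E_succ_iff j hm hp hφj

end BlowUpSequence

end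

theorem mainTheorem4 {X : ℕ → Type*} [∀ i, TopologicalSpace (X i)] [∀ i, T2Space (X i)]
    [∀ i, ChartedSpace (ℂ × ℂ) (X i)] [∀ i, IsManifold 𝓘(ℂ, ℂ × ℂ) ω (X i)]
    (T : BlowUpSequence X) {a b c : ℕ} (ha : a < T.length) (hsat : T.IsSatellite a b c) :
    IsDominatingValuation (T.divisorialValuation ha) ∧
      (∃ e, T.IsAdaptedChart a b c e) ∧
      ∀ e, T.IsAdaptedChart a b c e →
        T.divisorialValuation ha = T.monomialValuation ha e 1 1 := by
  refine ⟨T.isDominatingValuation_divisorialValuation ha, ?_, fun e he =>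
    T.divisorialValuation_eq_monomialValuation ha ⟨he.mem_atlas, he.mem_source, he.centred⟩⟩
  obtain ⟨e, he, hb, hc⟩ := T.exists_chart_E_inter_E hsat.ne ha.le hsat.proximate_direct
    hsat.proximate_indirect
  exact ⟨e, he.mem_atlas, he.mem_source, he.centred, hb, hc⟩
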